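/- Let $\theta>0$, $a>-1$, $b>-1$ with $a+b+1>0$, and put $\alpha=(a+b+1)/\theta-1$ (so $\alpha>-1$) and $h_n=\theta/(2n\theta+a+b+1)$. Let $(\hat P_n)_{n\ge0}$, $(\hat Q_n)_{n\ge 0}$ be $\theta$-deformed Cauchy bi-orthogonal polynomials with Laguerre weight, that is, real polynomials with $\deg\hat P_n=\deg\hat Q_n=n$ and $$\int_0^\infty\!\!\int_0^\infty \frac{e^{-(x+y)}}{x+y}\,x^a y^b\,\hat P_n(x^\theta)\,\hat Q_m(y^\theta)\,dx\,dy=\frac{h_n}{\theta}\,\delta_{n,m}\qquad(n,m\ge 0);$$ such families exist. Let $$K_N(x,y)=\sum_{n=0}^{N-1}\frac{\theta}{h_n}\,\hat P_n(x^\theta)\,\hat Q_n(y^\theta)$$ be their Christoffel–Darboux kernel. For $c>-1$ and complex $z\neq0$ let $$G^\theta_{\infty,c}(z)=\int_\gamma\frac{du}{2\pi i}\,\frac{\Gamma(u)\,z^{-u}}{\Gamma(\alpha-u+1)\,\Gamma(c-\theta u+1)},$$ where $\gamma$ is any loop $-\infty+i\varphi_1\to\delta+i\varphi_1\to\delta+i\varphi_2\to-\infty+i\varphi_2$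 with $\varphi_1<0<\varphi_2$ and $\delta>0$, which thus encloses the negative real axis and the origin once, counterclockwise. Then this integral converges absolutely, $$G^\theta_{\infty,c}(z)=\sum_{k=0}^\infty\frac{(-1)^k z^k}{k!\,\Gamma(\alpha+k+1)\,\Gamma(c+\theta k+1)},$$ and $G^\theta_{\infty,c}$ is the Fox H-function $$G^\theta_{\infty,c}(z)=H^{1,0}_{0,3}\!\left[z\,\middle|\,\begin{matrix}-\\(0,1);\,(-\alpha,1);\,(-c,\theta)\end{matrix}\right],$$ where $$H^{m,n}_{p,q}\!\left[z\,\middle|\,\begin{matrix}(a_1,A_1);\ldots;(a_p,A_p)\\(b_1,B_1);\ldots;(b_q,B_q)\end{matrix}\right]=\frac1{2\pi i}\int_\gamma\frac{\prod_{j=1}^m\Gamma(b_j+B_js)\prod_{j=1}^n\Gamma(1-a_j-A_js)}{\prod_{j=m+1}^q\Gamma(1-b_j-B_js)\prod_{j=n+1}^p\Gamma(a_j+A_js)}\,z^{-s}\,ds,$$ with $\gamma$ enclosing the poles of the $\Gamma(b_j+B_js)$, $j\le m$, and none of those of the $\Gamma(1-a_j-A_js)$, $j\le n$. Moreover, for all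 $X,Y>0$ the integral on the right below converges absolutely and $$\lim_{N\to\infty}N^{-2(\alpha+1)}\,K_N\!\left(\frac{X}{N^{2/\theta}},\frac{Y}{N^{2/\theta}}\right)=\theta\int_0^1 t^\alpha\,G^\theta_{\infty,a}(tX^\theta)\,G^\theta_{\infty,b}(tY^\theta)\,dt .$$ -/

import Mathlib

open MeasureTheory Set Filter Topology

noncomputable section

namespace CauchyLaguerre

/-- The pairing `⟨P, Q⟩ = ∬_{ℝ₊²} e^{-(x+y)}/(x+y) x^a y^b P(x^θ) Q(y^θ) dx dy`. -/
def pairing (a b θ : ℝ) (P Q : Polynomial ℝ) : ℝ :=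
  ∫ p in Ioi (0 : ℝ) ×ˢ Ioi (0 : ℝ),
    Real.exp (-(p.1 + p.2)) / (p.1 + p.2) * p.1 ^ a * p.2 ^ b *
      P.eval (p.1 ^ θ) * Q.eval (p.2 ^ θ)

/-- The normalisation `h_n = θ / (2 n θ + a + b + 1)`. -/
def h (a b θ : ℝ) (n : ℕ) : ℝ := θ / (2 * n * θ + a + b + 1)

/-- `(P n), (Q n)` are `θ`-deformed Cauchy bi-orthogonal polynomials with Laguerre weight:
`P n` and `Q n` have degree `n` and `⟨P n, Q m⟩ = (h_n / θ) δ_{n,m}`. -/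
structure IsBiorthogonal (a b θ : ℝ) (P Q : ℕ → Polynomial ℝ) : Prop where
  degree_left : ∀ n, (P n).degree = n
  degree_right : ∀ n, (Q n).degree = n
  biorthogonal : ∀ n m, pairing a b θ (P n) (Q m) = if n = m then h a b θ n / θ else 0

/-- The Christoffel–Darboux kernel `K_N(x,y) = ∑_{n<N} (θ/h_n) P_n(x^θ) Q_n(y^θ)`. -/
def cdKernel (a b θ : ℝ) (P Q : ℕ → Polynomial ℝ) (N : ℕ) (x y : ℝ) : ℝ :=
  ∑ n ∈ Finset.range N,
    θ / h a b θ n * (P n).eval (x ^ θ) * (Q n).eval (y ^ θ)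

/-- The parameter `α = (a+b+1)/θ - 1`. -/
def alpha (a b θ : ℝ) : ℝ := (a + b + 1) / θ - 1

/-- A left loop: the path `-∞ + i·lower → right + i·lower → right + i·upper → -∞ + i·upper`,
which runs once, counterclockwise, around the half strip to its left. -/
structure LeftLoop where
  right : ℝ
  lower : ℝ
  upper : ℝ
  lower_lt_upper : lower < upper

namespace LeftLoop

/-- The point `s` lies strictly inside the loop. -/
def Encloses (γ : LeftLoop) (s : ℂ) : Prop :=
  s.re < γ.right ∧ γ.lower < s.im ∧ s.im < γ.upper

/-- The point `s` lies strictly outside the loop. -/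
def Excludes (γ : LeftLoop) (s : ℂ) : Prop :=
  γ.right < s.re ∨ s.im < γ.lower ∨ γ.upper < s.im

/-- `f` is absolutely integrable along the loop. -/
def Integrable (γ : LeftLoop) (f : ℂ → ℂ) : Prop :=
  IntegrableOn (fun x : ℝ => f (x + γ.lower * Complex.I)) (Iic γ.right) ∧
  IntervalIntegrable (fun y : ℝ => f (γ.right + y * Complex.I)) volume γ.lower γ.upper ∧
  IntegrableOn (fun x : ℝ => f (x + γ.upper * Complex.I)) (Iic γ.right)

/-- The contour integral `∫_γ f(u) du / (2πi)`. -/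
def integral (γ : LeftLoop) (f : ℂ → ℂ) : ℂ :=
  (2 * Real.pi * Complex.I)⁻¹ *
    ((∫ x in Iic γ.right, f (x + γ.lower * Complex.I)) +
      Complex.I * (∫ y in γ.lower..γ.upper, f (γ.right + y * Complex.I)) -
      ∫ x in Iic γ.right, f (x + γ.upper * Complex.I))

end LeftLoop

/-- The Mellin–Barnes integrand
`∏_{j≤m} Γ(b_j+B_j s) ∏_{j≤n} Γ(1-a_j-A_j s) /
  (∏_{j>m} Γ(1-b_j-B_j s) ∏_{j>n} Γ(a_j+A_j s)) · z^{-s}`.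
At a pole of a denominator factor the quotient takes its correct value `0`. -/
def foxIntegrand {p q : ℕ} (m n : ℕ) (a : Fin p → ℂ) (A : Fin p → ℝ)
    (b : Fin q → ℂ) (B : Fin q → ℝ) (z s : ℂ) : ℂ :=
  (∏ j : Fin q with j.val < m, Complex.Gamma (b j + B j * s)) *
      (∏ j : Fin p with j.val < n, Complex.Gamma (1 - a j - A j * s)) /
    ((∏ j : Fin q with m ≤ j.val, Complex.Gamma (1 - b j - B j * s)) *
      (∏ j : Fin p with n ≤ j.val, Complex.Gamma (a j + A j * s))) * z ^ (-s)

/-- The left loop `γ` is suitable for the Fox H-function: it encloses all poles of the factors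
`Γ(b_j+B_j s)`, `j ≤ m`, excludes all poles of the factors `Γ(1-a_j-A_j s)`, `j ≤ n`, and the
Mellin–Barnes integral converges absolutely along it. -/
def FoxSuitable {p q : ℕ} (m n : ℕ) (a : Fin p → ℂ) (A : Fin p → ℝ)
    (b : Fin q → ℂ) (B : Fin q → ℝ) (z : ℂ) (γ : LeftLoop) : Prop :=
  (∀ j : Fin q, j.val < m → ∀ k : ℕ, γ.Encloses (-(b j + k) / B j)) ∧
  (∀ j : Fin p, j.val < n → ∀ k : ℕ, γ.Excludes ((1 - a j + k) / A j)) ∧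
  γ.Integrable (foxIntegrand m n a A b B z)

/-- The Fox H-function `H^{m,n}_{p,q}[z | (a_j,A_j); (b_j,B_j)]`, with contour the loop `γ`. -/
def foxH {p q : ℕ} (m n : ℕ) (a : Fin p → ℂ) (A : Fin p → ℝ)
    (b : Fin q → ℂ) (B : Fin q → ℝ) (γ : LeftLoop) (z : ℂ) : ℂ :=
  γ.integral (foxIntegrand m n a A b B z)

/-- The integrand `Γ(u) z^{-u} / (Γ(α-u+1) Γ(c-θu+1))`. -/
def gIntegrand (θ α c : ℝ) (z u : ℂ) : ℂ :=
  Complex.Gamma u * z ^ (-u) / (Complex.Gamma (α - u + 1) * Complex.Gamma (c - θ * u + 1))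

/-- `G^θ_{∞,c}(z) = ∫_γ du/(2πi) Γ(u) z^{-u} / (Γ(α-u+1) Γ(c-θu+1))`. -/
def gInf (γ : LeftLoop) (θ α c : ℝ) (z : ℂ) : ℂ :=
  γ.integral (gIntegrand θ α c z)

end CauchyLaguerre

end

/-! Write `s = α + 1 = (a+b+1)/θ`. Since `e^{-r}/r = ∫_1^∞ e^{-lr} dl`, the moments of the
Cauchy–Laguerre weight are explicit, and pairing `x^{iθ}` with `y^{jθ}` gives `Γ(a+iθ+1) Γ(b+jθ+1) /
(θ(s+i+j))` (`integral_momentDensity`, `pairing_eq_cauchy`). Once the Gamma factors are absorbed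
into the coefficients, only the Cauchy matrix `1/(s+i+j) = ∫_0^1 t^{s-1} t^i t^j dt` is left. A
biorthogonal pair is therefore obtained from the Jacobi polynomials on `[0,1]` with weight
`t^{s-1}`, by dividing coefficients by Gamma values (`isBiorthogonal_jacobiTransform`).

The coefficient matrix of a Christoffel–Darboux kernel is the inverse of the Gram matrix, so it is
the same for every biorthogonal system (`sum_coeff_mul_coeff_eq`). For the Jacobi system the sum
over `n` telescopes, and the coefficient of index `(k,l)` has the form `κ_k(N) κ_l(N) / (s+k+l)`
(`sum_jacobiFactor_mul`, `IsBiorthogonal.cdKernel_eq`).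

As `N → ∞`, `κ_k(N) / N^{s+2k}` tends to `(-1)^k / (k! Γ(s+k))` with a bound summable in `k`, so
dominated convergence gives a double series for the limit (`tendsto_scaled_cdKernel`). On the other
side, the loop integral is the sum of its residues at `0, -1, -2, …`: the reflection formula and the
superexponential decay of `1/Γ` make the remainder vanish (`hasSum_gTerm`). Multiplying the two
power series and integrating against `t^α` produces the same denominators `s+k+l`, hence the same
double series (`integral_gInf_mul_gInf`). -/

namespace CauchyLaguerre

/-! ### Moments of the Cauchy–Laguerre weight -/

section Moments

lemma integrableOn_rpow_mul_exp_neg_mul_Ioi {p r : ℝ} (hp : -1 < p) (hr : 0 < r) :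
    IntegrableOn (fun t : ℝ => t ^ p * Real.exp (-(r * t))) (Ioi 0) := by
  have hI := Real.integral_rpow_mul_exp_neg_mul_Ioi (a := p + 1) (by linarith) hr
  rw [add_sub_cancel_right] at hI
  -- The integral of a non-integrable function is 0 by convention, whereas the Gamma value is
  -- positive.
  by_contra hn
  rw [integral_undef hn] at hI
  have h1 : 0 < (1 / r) ^ (p + 1) * Real.Gamma (p + 1) :=
    mul_pos (Real.rpow_pos_of_pos (by positivity) _) (Real.Gamma_pos_of_pos (by linarith))
  linarith

lemma lintegral_rpow_mul_exp_neg_mul_Ioi {p r : ℝ} (hp : -1 < p) (hr : 0 < r) :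
    ∫⁻ t in Ioi (0 : ℝ), ENNReal.ofReal (t ^ p * Real.exp (-(r * t))) =
      ENNReal.ofReal (r ^ (-(p + 1)) * Real.Gamma (p + 1)) := by
  have hI := Real.integral_rpow_mul_exp_neg_mul_Ioi (a := p + 1) (by linarith) hr
  rw [add_sub_cancel_right] at hI
  rw [← ofReal_integral_eq_lintegral_ofReal (integrableOn_rpow_mul_exp_neg_mul_Ioi hp hr), hI,
    one_div, Real.inv_rpow hr.le, Real.rpow_neg hr.le]
  filter_upwards [self_mem_ae_restrict measurableSet_Ioi] with t ht
  exact mul_nonneg (Real.rpow_nonneg (mem_Ioi.1 ht).le _) (Real.exp_nonneg _)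

lemma lintegral_exp_neg_mul_Ioi_one {c : ℝ} (hc : 0 < c) :
    ∫⁻ t in Ioi (1 : ℝ), ENNReal.ofReal (Real.exp (-(t * c))) =
      ENNReal.ofReal (Real.exp (-c) / c) := by
  have hI := integral_exp_mul_Ioi (a := -c) (by linarith) 1
  have hint := integrableOn_exp_mul_Ioi (a := -c) (by linarith) 1
  have he : ∀ t : ℝ, -(t * c) = -c * t := fun t => by ring
  simp only [he]
  rw [← ofReal_integral_eq_lintegral_ofReal hint, hI]
  · congr 1
    rw [mul_one, neg_div_neg_eq]
  · exact Eventually.of_forall fun t => Real.exp_nonneg _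

/-- The weight `e^{-(x+y)}/(x+y) x^p y^q`. -/
noncomputable def momentDensity (p q : ℝ) (z : ℝ × ℝ) : ℝ :=
  Real.exp (-(z.1 + z.2)) / (z.1 + z.2) * z.1 ^ p * z.2 ^ q

lemma measurable_momentDensity (p q : ℝ) : Measurable (momentDensity p q) := by
  unfold momentDensity
  fun_prop

lemma momentDensity_nonneg {p q : ℝ} {z : ℝ × ℝ} (hz : z ∈ Ioi (0 : ℝ) ×ˢ Ioi (0 : ℝ)) :
    0 ≤ momentDensity p q z := by
  obtain ⟨h1, h2⟩ := hz
  simp only [mem_Ioi] at h1 h2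
  unfold momentDensity
  positivity

/-- Writing `e^{-(x+y)}/(x+y)` as `∫_1^∞ e^{-l(x+y)} dl` decouples `x` from `y`. By Tonelli each
variable contributes a Gamma integral, and `∫_1^∞ l^{-(p+q+2)} dl = 1/(p+q+1)`. Working with
`lintegral` yields integrability and the value of the integral together. -/
lemma lintegral_momentDensity {p q : ℝ} (hp : -1 < p) (hq : -1 < q) (hpq : 0 < p + q + 1) :
    ∫⁻ z in Ioi (0 : ℝ) ×ˢ Ioi (0 : ℝ), ENNReal.ofReal (momentDensity p q z) =
      ENNReal.ofReal (Real.Gamma (p + 1) * Real.Gamma (q + 1) / (p + q + 1)) := by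
  let F : ℝ → ℝ → ℝ → ENNReal := fun r l x => ENNReal.ofReal (x ^ r * Real.exp (-(l * x)))
  have hF : ∀ r, Measurable (fun z : ℝ × ℝ => F r z.1 z.2) := by
    intro r
    simp only [F]
    fun_prop
  have hrepr : ∀ z ∈ Ioi (0 : ℝ) ×ˢ Ioi (0 : ℝ), ENNReal.ofReal (momentDensity p q z) =
      ∫⁻ l in Ioi (1 : ℝ), F p l z.1 * F q l z.2 := by
    rintro ⟨x, y⟩ ⟨hx, hy⟩
    simp only [mem_Ioi] at hx hy
    have hxp := Real.rpow_nonneg hx.le p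
    have hyq := Real.rpow_nonneg hy.le q
    have : ∀ l : ℝ, F p l x * F q l y =
        ENNReal.ofReal (x ^ p * y ^ q) * ENNReal.ofReal (Real.exp (-(l * (x + y)))) := by
      intro l
      simp only [F]
      rw [← ENNReal.ofReal_mul (by positivity), ← ENNReal.ofReal_mul (by positivity)]
      congr 1
      rw [show -(l * (x + y)) = -(l * x) + -(l * y) by ring, Real.exp_add]
      ring
    simp only [this]
    rw [lintegral_const_mul _ (by fun_prop), lintegral_exp_neg_mul_Ioi_one (by linarith),
      ← ENNReal.ofReal_mul (by positivity)]
    congr 1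
    simp only [momentDensity]
    ring
  rw [setLIntegral_congr_fun (measurableSet_Ioi.prod measurableSet_Ioi) hrepr]
  rw [lintegral_lintegral_swap]
  · have hinner : ∀ l ∈ Ioi (1 : ℝ), ∫⁻ z in Ioi (0 : ℝ) ×ˢ Ioi (0 : ℝ), F p l z.1 * F q l z.2 =
        ENNReal.ofReal (Real.Gamma (p + 1) * Real.Gamma (q + 1) * l ^ (-(p + q + 2))) := by
      intro l hl
      have hl0 : 0 < l := lt_trans one_pos hl
      rw [Measure.volume_eq_prod, ← Measure.prod_restrict, lintegral_prod_mul]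
      · simp only [F]
        rw [lintegral_rpow_mul_exp_neg_mul_Ioi hp hl0, lintegral_rpow_mul_exp_neg_mul_Ioi hq hl0,
          ← ENNReal.ofReal_mul]
        · congr 1
          rw [show -(p + q + 2) = -(p + 1) + -(q + 1) by ring, Real.rpow_add hl0]
          ring
        · exact mul_nonneg (Real.rpow_nonneg hl0.le _) (Real.Gamma_pos_of_pos (by linarith)).le
      · exact ((hF p).comp measurable_prodMk_left).aemeasurable
      · exact ((hF q).comp measurable_prodMk_left).aemeasurable
    rw [setLIntegral_congr_fun measurableSet_Ioi hinner]
    have hG : 0 ≤ Real.Gamma (p + 1) * Real.Gamma (q + 1) :=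
      mul_nonneg (Real.Gamma_pos_of_pos (by linarith)).le (Real.Gamma_pos_of_pos (by linarith)).le
    rw [← ofReal_integral_eq_lintegral_ofReal]
    · rw [integral_const_mul, integral_Ioi_rpow_of_lt (by linarith) one_pos, Real.one_rpow]
      congr 1
      rw [show -(p + q + 2) + 1 = -(p + q + 1) by ring, neg_div_neg_eq]
      ring
    · exact (integrableOn_Ioi_rpow_of_lt (by linarith) one_pos).const_mul _
    · filter_upwards [self_mem_ae_restrict measurableSet_Ioi] with t ht
      exact mul_nonneg hG (Real.rpow_nonneg (lt_trans one_pos ht).le _)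
  · apply Measurable.aemeasurable
    exact ((hF p).comp (measurable_snd.prodMk (measurable_fst.comp measurable_fst))).mul
      ((hF q).comp (measurable_snd.prodMk (measurable_snd.comp measurable_fst)))

lemma integrableOn_momentDensity {p q : ℝ} (hp : -1 < p) (hq : -1 < q) (hpq : 0 < p + q + 1) :
    IntegrableOn (momentDensity p q) (Ioi (0 : ℝ) ×ˢ Ioi (0 : ℝ)) := by
  refine ⟨(measurable_momentDensity p q).aestronglyMeasurable, ?_⟩
  rw [hasFiniteIntegral_iff_ofReal, lintegral_momentDensity hp hq hpq]
  · exact ENNReal.ofReal_lt_top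
  · filter_upwards [self_mem_ae_restrict (measurableSet_Ioi.prod measurableSet_Ioi)] with z hz
    exact momentDensity_nonneg hz

lemma integral_momentDensity {p q : ℝ} (hp : -1 < p) (hq : -1 < q) (hpq : 0 < p + q + 1) :
    ∫ z in Ioi (0 : ℝ) ×ˢ Ioi (0 : ℝ), momentDensity p q z =
      Real.Gamma (p + 1) * Real.Gamma (q + 1) / (p + q + 1) := by
  rw [integral_eq_lintegral_of_nonneg_ae, lintegral_momentDensity hp hq hpq,
    ENNReal.toReal_ofReal]
  · exact div_nonneg (mul_nonneg (Real.Gamma_pos_of_pos (by linarith)).le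
      (Real.Gamma_pos_of_pos (by linarith)).le) hpq.le
  · filter_upwards [self_mem_ae_restrict (measurableSet_Ioi.prod measurableSet_Ioi)] with z hz
    exact momentDensity_nonneg hz
  · exact (measurable_momentDensity p q).aestronglyMeasurable

/-- The pairing in terms of coefficients. -/
lemma pairing_eq_sum {a b θ : ℝ} (hθ : 0 < θ) (ha : -1 < a) (hb : -1 < b) (hab : 0 < a + b + 1)
    {P Q : Polynomial ℝ} {M N : ℕ} (hP : P.natDegree < M) (hQ : Q.natDegree < N) :
    pairing a b θ P Q = ∑ i ∈ Finset.range M, ∑ j ∈ Finset.range N,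
      P.coeff i * Q.coeff j *
        (Real.Gamma (a + i * θ + 1) * Real.Gamma (b + j * θ + 1) / (a + b + 1 + (i + j) * θ)) := by
  have hi : ∀ i : ℕ, 0 ≤ (i : ℝ) * θ := fun i => by positivity
  have hexp : ∀ z ∈ Ioi (0 : ℝ) ×ˢ Ioi (0 : ℝ),
      Real.exp (-(z.1 + z.2)) / (z.1 + z.2) * z.1 ^ a * z.2 ^ b *
        P.eval (z.1 ^ θ) * Q.eval (z.2 ^ θ) =
      ∑ i ∈ Finset.range M, ∑ j ∈ Finset.range N,
        P.coeff i * Q.coeff j * momentDensity (a + i * θ) (b + j * θ) z := by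
    rintro ⟨x, y⟩ ⟨hx, hy⟩
    simp only [mem_Ioi] at hx hy
    simp only [momentDensity]
    rw [Polynomial.eval_eq_sum_range' hP, Polynomial.eval_eq_sum_range' hQ, mul_assoc,
      Finset.sum_mul_sum, Finset.mul_sum]
    refine Finset.sum_congr rfl fun i _ => ?_
    rw [Finset.mul_sum]
    refine Finset.sum_congr rfl fun j _ => ?_
    rw [Real.rpow_add hx, Real.rpow_add hy, mul_comm (i : ℝ), mul_comm (j : ℝ), Real.rpow_mul hx.le,
      Real.rpow_mul hy.le, Real.rpow_natCast, Real.rpow_natCast]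
    ring
  have hint : ∀ i j : ℕ, IntegrableOn (momentDensity (a + i * θ) (b + j * θ))
      (Ioi (0 : ℝ) ×ˢ Ioi (0 : ℝ)) := fun i j =>
    integrableOn_momentDensity (by linarith [hi i]) (by linarith [hi j])
      (by linarith [hi i, hi j])
  unfold pairing
  rw [setIntegral_congr_fun (measurableSet_Ioi.prod measurableSet_Ioi) hexp]
  rw [integral_finsetSum _ fun i _ => integrable_finsetSum _ fun j _ => (hint i j).const_mul _]
  refine Finset.sum_congr rfl fun i _ => ?_
  rw [integral_finsetSum _ fun j _ => (hint i j).const_mul _]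
  refine Finset.sum_congr rfl fun j _ => ?_
  rw [integral_const_mul, integral_momentDensity (by linarith [hi i]) (by linarith [hi j])
      (by linarith [hi i, hi j])]
  congr 2
  ring

end Moments

/-! ### Jacobi polynomials on [0,1] and the Cauchy matrix -/

section Jacobi

/-- Coefficients of the Jacobi polynomials on `[0,1]` with weight `t^(s-1)`. -/
noncomputable def jacobiCoeff (s : ℝ) (n k : ℕ) : ℝ :=
  (-1) ^ k * n.choose k * (∏ j ∈ Finset.range n, (s + k + j)) / n.factorial

lemma jacobiCoeff_eq_zero_of_lt (s : ℝ) {n k : ℕ} (hnk : n < k) : jacobiCoeff s n k = 0 := by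
  simp [jacobiCoeff, Nat.choose_eq_zero_of_lt hnk]

/-- Pascal's rule followed by an index shift: an alternating binomial sum of order `n+1` is one of
order `n` applied to differences. This drives the induction for the partial fractions of
`n!/(x(x+1)⋯(x+n))`. -/
lemma alternating_sum_choose_succ (n : ℕ) (f : ℕ → ℝ) :
    ∑ i ∈ Finset.range (n + 2), (-1) ^ i * ((n + 1).choose i : ℝ) * f i =
      ∑ i ∈ Finset.range (n + 1), (-1) ^ i * (n.choose i : ℝ) * (f i - f (i + 1)) := by
  rw [Finset.sum_range_succ']
  simp only [Nat.choose_succ_succ, Nat.cast_add, mul_sub, Finset.sum_sub_distrib]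
  have h1 : ∑ i ∈ Finset.range (n + 1), (-1 : ℝ) ^ i * (n.choose i : ℝ) * f i =
      ∑ i ∈ Finset.range (n + 1), (-1 : ℝ) ^ (i + 1) * (n.choose (i + 1) : ℝ) * f (i + 1) + f 0 := by
    have h2 := Finset.sum_range_succ' (fun i => (-1 : ℝ) ^ i * (n.choose i : ℝ) * f i) (n + 1)
    rw [Finset.sum_range_succ] at h2
    simpa using h2
  rw [h1, add_sub_right_comm, ← Finset.sum_sub_distrib]
  simp only [pow_zero, Nat.choose_zero_right, Nat.cast_one, one_mul]
  congr 1
  exact Finset.sum_congr rfl fun i _ => by ring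

lemma alternating_sum_choose_div (n : ℕ) {x : ℝ} (hx : 0 < x) :
    ∑ i ∈ Finset.range (n + 1), (-1) ^ i * (n.choose i : ℝ) * (1 / (x + i)) =
      n.factorial / ∏ j ∈ Finset.range (n + 1), (x + j) := by
  induction n generalizing x with
  | zero => simp
  | succ n ih =>
    rw [alternating_sum_choose_succ n fun i => 1 / (x + i)]
    simp only [mul_sub, Finset.sum_sub_distrib]
    have h2 := ih (x := x + 1) (by linarith)
    have e : ∀ i : ℕ, x + ((i + 1 : ℕ) : ℝ) = x + 1 + i := fun i => by push_cast; ring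
    simp only [e]
    rw [ih hx, h2]
    have hp : ∀ (y : ℝ) (_ : 0 < y) (m : ℕ), (∏ j ∈ Finset.range m, (y + j)) ≠ 0 :=
      fun y hy m => Finset.prod_ne_zero_iff.2 fun j _ => by positivity
    have ea : ∏ j ∈ Finset.range (n + 1 + 1), (x + (j : ℝ)) =
        (∏ j ∈ Finset.range (n + 1), (x + (j : ℝ))) * (x + n + 1) := by
      rw [Finset.prod_range_succ]; push_cast; ring
    have eb : ∏ j ∈ Finset.range (n + 1 + 1), (x + (j : ℝ)) =
        (∏ j ∈ Finset.range (n + 1), (x + 1 + (j : ℝ))) * x := by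
      rw [Finset.prod_range_succ']; simp only [e]; simp
    have hA := hp x hx (n + 1)
    have hB := hp (x + 1) (by linarith) (n + 1)
    have hC := hp x hx (n + 1 + 1)
    rw [div_sub_div _ _ hA hB, div_eq_div_iff (mul_ne_zero hA hB) hC, Nat.factorial_succ]
    push_cast
    generalize (∏ j ∈ Finset.range (n + 1), (x + (j : ℝ))) = A at *
    generalize (∏ j ∈ Finset.range (n + 1), (x + 1 + (j : ℝ))) = B at *
    generalize (∏ j ∈ Finset.range (n + 1 + 1), (x + (j : ℝ))) = C at *
    have : B * x = A * (x + n + 1) := by rw [← ea, eb]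
    rw [ea]
    linear_combination (n.factorial : ℝ) * A * this

lemma alternating_sum_choose_polynomial {p : Polynomial ℝ} {n : ℕ} (hp : p.natDegree < n)
    (x : ℝ) : ∑ i ∈ Finset.range (n + 1), (-1) ^ i * (n.choose i : ℝ) * p.eval (x + i) = 0 := by
  have h1 := congrFun (Polynomial.fwdDiff_iter_eq_zero_of_degree_lt hp) x
  rw [fwdDiff_iter_eq_sum_shift] at h1
  have h2 : ∑ i ∈ Finset.range (n + 1), (-1) ^ i * (n.choose i : ℝ) * p.eval (x + i) =
      (-1) ^ n * ∑ i ∈ Finset.range (n + 1),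
        (((-1 : ℤ) ^ (n - i) * (n.choose i : ℤ)) • p.eval (x + i • (1 : ℝ))) := by
    rw [Finset.mul_sum]
    refine Finset.sum_congr rfl fun i hi => ?_
    have hi' : i ≤ n := by simpa [Nat.lt_succ_iff] using hi
    have : (-1 : ℝ) ^ n * (-1) ^ (n - i) = (-1) ^ i := by
      obtain ⟨d, rfl⟩ := Nat.exists_eq_add_of_le hi'
      rw [Nat.add_sub_cancel_left, pow_add, mul_assoc, ← mul_pow]
      simp
    rw [← this]
    simp
    ring
  rw [h2, h1]
  simp

lemma prod_range_cast_sub {R : Type*} [CommRing R] (n : ℕ) :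
    ∏ j ∈ Finset.range n, ((j : R) - n) = (-1) ^ n * n.factorial := by
  rw [← Finset.prod_range_reflect]
  have : ∀ j ∈ Finset.range n, (((n - 1 - j : ℕ) : R) - n) = (-1) * ((j + 1 : ℕ) : R) := by
    intro j hj
    have hj' := Finset.mem_range.1 hj
    rw [Nat.sub_sub, Nat.cast_sub (by omega)]
    push_cast
    ring
  rw [Finset.prod_congr rfl this, Finset.prod_mul_distrib, Finset.prod_const,
    Finset.card_range, ← Finset.prod_range_add_one_eq_factorial]
  push_cast
  rfl

/-- The rising factorial in `jacobiCoeff s n i` is a polynomial `p` of degree `n` evaluated at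
`s+m+i`. Splitting `p = X q + p(0)`, the part `q` has degree below `n` and is killed by the `n`-th
difference, while `p(0)` multiplies a partial fraction sum. The factor `p(0) = ∏ (j-m)` vanishes for
`m < n`, which is orthogonality to lower powers. -/
lemma sum_jacobiCoeff_div {s : ℝ} (hs : 0 < s) {n m : ℕ} (hmn : m ≤ n) :
    ∑ i ∈ Finset.range (n + 1), jacobiCoeff s n i / (s + i + m) =
      (∏ j ∈ Finset.range n, ((j : ℝ) - m)) / ∏ j ∈ Finset.range (n + 1), (s + m + j) := by
  let p : Polynomial ℝ := ∏ j ∈ Finset.range n, (Polynomial.X + Polynomial.C ((j : ℝ) - m))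
  have hev : ∀ x, p.eval x = ∏ j ∈ Finset.range n, (x + (j - m)) := by
    intro x
    simp [p, Polynomial.eval_prod]
  have hdeg : p.natDegree ≤ n := by
    refine (Polynomial.natDegree_prod_le _ _).trans ?_
    simp only [Polynomial.natDegree_X_add_C, Finset.sum_const, Finset.card_range, smul_eq_mul,
      mul_one, le_refl]
  have h0 : p.coeff 0 = ∏ j ∈ Finset.range n, ((j : ℝ) - m) := by
    rw [Polynomial.coeff_zero_eq_eval_zero, hev]
    simp
  have hterm : ∀ i : ℕ, jacobiCoeff s n i / (s + i + m) = (n.factorial : ℝ)⁻¹ *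
      ((-1) ^ i * (n.choose i : ℝ) * p.divX.eval (s + m + i) +
        p.coeff 0 * ((-1) ^ i * (n.choose i : ℝ) * (1 / (s + m + i)))) := by
    intro i
    have hx : s + m + i ≠ 0 := by positivity
    have hprod : ∏ j ∈ Finset.range n, (s + i + (j : ℝ)) =
        p.divX.eval (s + m + i) * (s + m + i) + p.coeff 0 := by
      have : p.eval (s + m + i) = p.divX.eval (s + m + i) * (s + m + i) + p.coeff 0 := by
        conv_lhs => rw [← Polynomial.divX_mul_X_add p]
        simp
      rw [← this, hev]
      exact Finset.prod_congr rfl fun j _ => by ring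
    rw [jacobiCoeff, hprod, show s + i + (m : ℝ) = s + m + i by ring]
    field_simp
  simp only [hterm]
  rw [← Finset.mul_sum, Finset.sum_add_distrib, ← Finset.mul_sum,
    alternating_sum_choose_div n (by positivity : 0 < s + m), h0]
  have hz : ∑ i ∈ Finset.range (n + 1), (-1) ^ i * (n.choose i : ℝ) * p.divX.eval (s + m + i) = 0 := by
    -- For `n = 0` no degree is below `n`, but then `p = 1` and `q = 0`.
    rcases Nat.eq_zero_or_pos n with rfl | hn
    · have : p.divX = 0 := by simp [p]
      simp [this]
    · refine alternating_sum_choose_polynomial ?_ _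
      rw [Polynomial.natDegree_divX_eq_natDegree_tsub_one]
      omega
  rw [hz]
  have : (n.factorial : ℝ) ≠ 0 := by positivity
  field_simp
  ring

lemma sum_sum_jacobiCoeff_of_lt {s : ℝ} (hs : 0 < s) {n m M N : ℕ} (hmn : m < n) (hn : n < N) :
    ∑ i ∈ Finset.range N, ∑ j ∈ Finset.range M,
      jacobiCoeff s n i * jacobiCoeff s m j / (s + i + j) = 0 := by
  rw [Finset.sum_comm]
  refine Finset.sum_eq_zero fun j _ => ?_
  rcases lt_or_ge m j with hj | hj
  · simp [jacobiCoeff_eq_zero_of_lt s hj]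
  · have h1 := sum_jacobiCoeff_div hs (hj.trans hmn.le)
    rw [Finset.prod_eq_zero (Finset.mem_range.2 (lt_of_le_of_lt hj hmn)) (sub_self _),
      zero_div] at h1
    rw [← Finset.sum_subset (Finset.range_mono (Nat.succ_le_of_lt hn))]
    · calc _ = jacobiCoeff s m j * ∑ i ∈ Finset.range (n + 1), jacobiCoeff s n i / (s + i + j) := by
            rw [Finset.mul_sum]
            exact Finset.sum_congr rfl fun i _ => by ring
        _ = 0 := by rw [h1, mul_zero]
    · intro i _ hi
      rw [jacobiCoeff_eq_zero_of_lt s (by simpa using hi)]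
      simp

/-- Orthogonality to lower powers leaves only the leading term `j = n` of the second factor. -/
lemma sum_sum_jacobiCoeff_self {s : ℝ} (hs : 0 < s) {n M N : ℕ} (hM : n < M) (hN : n < N) :
    ∑ i ∈ Finset.range M, ∑ j ∈ Finset.range N,
      jacobiCoeff s n i * jacobiCoeff s n j / (s + i + j) = 1 / (2 * n + s) := by
  rw [Finset.sum_comm, Finset.sum_eq_single n]
  · have h1 := sum_jacobiCoeff_div hs (le_refl n)
    rw [← Finset.sum_subset (Finset.range_mono (Nat.succ_le_of_lt hM))]
    · calc _ = jacobiCoeff s n n * ∑ i ∈ Finset.range (n + 1), jacobiCoeff s n i / (s + i + n) := by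
            rw [Finset.mul_sum]
            exact Finset.sum_congr rfl fun i _ => by ring
        _ = _ := by
          have hne : ∏ j ∈ Finset.range n, (s + n + (j : ℝ)) ≠ 0 :=
            Finset.prod_ne_zero_iff.2 fun j _ => by positivity
          have hne2 : s + n + (n : ℝ) ≠ 0 := by positivity
          have hne3 : 2 * (n : ℝ) + s ≠ 0 := by positivity
          have hne4 : (n.factorial : ℝ) ≠ 0 := by positivity
          have hsq : ((-1 : ℝ) ^ n) * (-1) ^ n = 1 := by rw [← mul_pow]; simp
          rw [h1, prod_range_cast_sub, Finset.prod_range_succ, jacobiCoeff, Nat.choose_self]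
          field_simp
          push_cast
          linear_combination (2 * (n : ℝ) + s) * hsq
    · intro i _ hi
      rw [jacobiCoeff_eq_zero_of_lt s (by simpa using hi)]
      simp
  · intro j _ hj
    rcases lt_or_gt_of_ne hj with hj | hj
    · have h1 := sum_jacobiCoeff_div hs hj.le
      rw [Finset.prod_eq_zero (Finset.mem_range.2 hj) (sub_self _), zero_div] at h1
      rw [← Finset.sum_subset (Finset.range_mono (Nat.succ_le_of_lt hM))]
      · calc _ = jacobiCoeff s n j * ∑ i ∈ Finset.range (n + 1), jacobiCoeff s n i / (s + i + j) := by
              rw [Finset.mul_sum]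
              exact Finset.sum_congr rfl fun i _ => by ring
          _ = 0 := by rw [h1, mul_zero]
      · intro i _ hi
        rw [jacobiCoeff_eq_zero_of_lt s (by simpa using hi)]
        simp
    · simp [jacobiCoeff_eq_zero_of_lt s hj]
  · intro hn
    exact absurd (Finset.mem_range.2 hN) hn

lemma sum_sum_jacobiCoeff {s : ℝ} (hs : 0 < s) {n m M N : ℕ} (hn : n < M) (hm : m < N) :
    ∑ i ∈ Finset.range M, ∑ j ∈ Finset.range N,
      jacobiCoeff s n i * jacobiCoeff s m j / (s + i + j) =
        if n = m then 1 / (2 * n + s) else 0 := by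
  rcases lt_trichotomy n m with h1 | rfl | h1
  · rw [if_neg h1.ne, Finset.sum_comm, ← sum_sum_jacobiCoeff_of_lt (M := M) hs h1 hm]
    exact Finset.sum_congr rfl fun i _ => Finset.sum_congr rfl fun j _ => by
      rw [mul_comm (jacobiCoeff s n j), add_right_comm]
  · rw [if_pos rfl, sum_sum_jacobiCoeff_self hs hn hm]
  · rw [if_neg h1.ne', sum_sum_jacobiCoeff_of_lt hs h1 hn]

end Jacobi

/-! ### The Christoffel–Darboux kernel in closed form -/

section Kernel

/-- `e_k(n) = (s)_n / n! ∏_{j<k} (n-j)(s+n+j)`. -/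
noncomputable def jacobiFactor (s : ℝ) (k n : ℕ) : ℝ :=
  (∏ j ∈ Finset.range n, (s + j)) / n.factorial *
    ((∏ j ∈ Finset.range k, ((n : ℝ) - j)) * ∏ j ∈ Finset.range k, (s + n + j))

lemma prod_range_add_ne_zero {s : ℝ} (hs : 0 < s) (n : ℕ) : ∏ j ∈ Finset.range n, (s + j) ≠ 0 :=
  Finset.prod_ne_zero_iff.2 fun j _ => by positivity

/-- Separates the dependence on `n`, so that the sum over `n` in the kernel involves only
`jacobiFactor`. -/
lemma jacobiCoeff_eq {s : ℝ} (hs : 0 < s) (n k : ℕ) :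
    jacobiCoeff s n k =
      (-1) ^ k / (k.factorial * ∏ j ∈ Finset.range k, (s + j)) * jacobiFactor s k n := by
  have hk := prod_range_add_ne_zero hs k
  have h1 : ∏ j ∈ Finset.range k, ((n : ℝ) - j) = n.choose k * k.factorial := by
    have : (n.descFactorial k : ℝ) = ∏ j ∈ Finset.range k, ((n : ℝ) - j) := by
      rw [Nat.descFactorial_eq_prod_range]
      push_cast
      rcases le_or_gt k n with hkn | hkn
      · refine Finset.prod_congr rfl fun j hj => ?_
        rw [Nat.cast_sub ((Finset.mem_range.1 hj).le.trans hkn)]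
      · rw [Finset.prod_eq_zero (Finset.mem_range.2 hkn), Finset.prod_eq_zero (Finset.mem_range.2 hkn)]
        · simp
        · simp
    rw [← this, Nat.descFactorial_eq_factorial_mul_choose]
    push_cast
    ring
  -- Both sides are the rising factorial of `s` of length `n + k`, cut at `k` or at `n`.
  have h2 : (∏ j ∈ Finset.range k, (s + j)) * ∏ j ∈ Finset.range n, (s + k + j) =
      (∏ j ∈ Finset.range n, (s + j)) * ∏ j ∈ Finset.range k, (s + n + j) := by
    have e1 := Finset.prod_range_add (fun j : ℕ => s + (j : ℝ)) k n
    have e2 := Finset.prod_range_add (fun j : ℕ => s + (j : ℝ)) n k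
    rw [add_comm n k] at e2
    simp only [Nat.cast_add, ← add_assoc] at e1 e2
    rw [← e1, e2]
  have hf : (n.factorial : ℝ) ≠ 0 := by positivity
  have hf' : (k.factorial : ℝ) ≠ 0 := by positivity
  rw [jacobiCoeff, jacobiFactor, h1]
  field_simp
  linear_combination (n.choose k : ℝ) * h2

/-- The first-order recurrence in `n` behind the telescoping. In this form without division it also
covers `k = n + 1`, where both sides vanish. -/
lemma jacobiFactor_succ (s : ℝ) (k n : ℕ) :
    ((n + 1 : ℕ) - k : ℝ) * jacobiFactor s k (n + 1) = (s + n + k) * jacobiFactor s k n := by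
  have h1 : (∏ j ∈ Finset.range k, (((n + 1 : ℕ) : ℝ) - j)) * ((n + 1 : ℕ) - k) =
      (n + 1) * ∏ j ∈ Finset.range k, ((n : ℝ) - j) := by
    rw [← Finset.prod_range_succ (fun j : ℕ => (((n + 1 : ℕ) : ℝ) - j)), Finset.prod_range_succ']
    push_cast
    simp only [add_sub_add_right_eq_sub, sub_zero]
    ring
  have h2 : (∏ j ∈ Finset.range k, (s + (n + 1 : ℕ) + j)) * (s + n) =
      (∏ j ∈ Finset.range k, (s + n + j)) * (s + n + k) := by
    rw [← Finset.prod_range_succ (fun j : ℕ => s + (n : ℝ) + j), Finset.prod_range_succ']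
    push_cast
    rw [add_zero]
    congr 1
    exact Finset.prod_congr rfl fun j _ => by ring
  have hf : (n.factorial : ℝ) ≠ 0 := by positivity
  have hn : (n : ℝ) + 1 ≠ 0 := by positivity
  rw [jacobiFactor, jacobiFactor, Finset.prod_range_succ, Nat.factorial_succ, Nat.cast_mul,
    Nat.cast_succ]
  rw [Nat.cast_succ] at h1 h2
  generalize (∏ j ∈ Finset.range n, (s + (j : ℝ))) = W at *
  generalize (∏ j ∈ Finset.range k, ((n : ℝ) + 1 - j)) = A at *
  generalize (∏ j ∈ Finset.range k, ((n : ℝ) - j)) = B at *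
  generalize (∏ j ∈ Finset.range k, (s + ((n : ℝ) + 1) + j)) = C at *
  generalize (∏ j ∈ Finset.range k, (s + (n : ℝ) + j)) = D at *
  field_simp
  linear_combination W * C * (s + n) * h1 + W * (n + 1) * B * h2

/-- The Christoffel–Darboux sums telescope. -/
lemma sum_jacobiFactor_mul {s : ℝ} (hs : 0 < s) (k l N : ℕ) :
    ∑ n ∈ Finset.range N, (2 * n + s) * (jacobiFactor s k n * jacobiFactor s l n) =
      (((N : ℝ) - k) * jacobiFactor s k N) * (((N : ℝ) - l) * jacobiFactor s l N) /
        (s + k + l) := by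
  have hne : s + k + l ≠ 0 := by positivity
  induction N with
  | zero =>
    -- The boundary term vanishes: through the factor `0 - k` if `k = 0`, through the `j = 0` factor
    -- of the product otherwise.
    have : ((0 : ℕ) - k : ℝ) * jacobiFactor s k 0 = 0 := by
      rcases Nat.eq_zero_or_pos k with rfl | hk
      · simp
      · have : ∏ j ∈ Finset.range k, (((0 : ℕ) : ℝ) - j) = 0 :=
          Finset.prod_eq_zero (Finset.mem_range.2 hk) (by simp)
        rw [jacobiFactor, this]
        simp
    rw [this]
    simp
  | succ N ih =>
    -- What remains is `(s+N+k)(s+N+l) - (N-k)(N-l) = (2N+s)(s+k+l)`.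
    rw [Finset.sum_range_succ, ih, jacobiFactor_succ, jacobiFactor_succ]
    field_simp
    ring

/-- The coefficients of the Christoffel–Darboux kernel. -/
noncomputable def kernelFactor (s : ℝ) (k N : ℕ) : ℝ :=
  (-1) ^ k / (k.factorial * ∏ j ∈ Finset.range k, (s + j)) *
    (((N : ℝ) - k) * jacobiFactor s k N)

/-- For `k, l < N` these are the entries of the inverse of the `N × N` Cauchy matrix `1/(s+i+j)`. -/
lemma sum_jacobiCoeff_mul {s : ℝ} (hs : 0 < s) (k l N : ℕ) :
    ∑ n ∈ Finset.range N, (2 * n + s) * (jacobiCoeff s n k * jacobiCoeff s n l) =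
      kernelFactor s k N * kernelFactor s l N / (s + k + l) := by
  simp only [jacobiCoeff_eq hs, kernelFactor]
  calc _ = (-1) ^ k / (k.factorial * ∏ j ∈ Finset.range k, (s + j)) *
        ((-1) ^ l / (l.factorial * ∏ j ∈ Finset.range l, (s + j))) *
        ∑ n ∈ Finset.range N, (2 * n + s) * (jacobiFactor s k n * jacobiFactor s l n) := by
        rw [Finset.mul_sum]
        exact Finset.sum_congr rfl fun n _ => by ring
    _ = _ := by
        rw [sum_jacobiFactor_mul hs]
        ring

/-- The polynomial with coefficients `jacobiCoeff s n k / Γ(c + kθ + 1)`. -/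
noncomputable def jacobiTransform (s c θ : ℝ) (n : ℕ) : Polynomial ℝ :=
  ∑ k ∈ Finset.range (n + 1),
    Polynomial.monomial k (jacobiCoeff s n k / Real.Gamma (c + k * θ + 1))

lemma coeff_jacobiTransform (s c θ : ℝ) (n k : ℕ) :
    (jacobiTransform s c θ n).coeff k = jacobiCoeff s n k / Real.Gamma (c + k * θ + 1) := by
  rw [jacobiTransform, Polynomial.finsetSum_coeff]
  simp only [Polynomial.coeff_monomial]
  rw [Finset.sum_ite_eq']
  split_ifs with hk
  · rfl
  · rw [jacobiCoeff_eq_zero_of_lt s (by simpa using hk), zero_div]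

lemma Gamma_shift_pos {c θ : ℝ} (hθ : 0 < θ) (hc : -1 < c) (k : ℕ) :
    0 < Real.Gamma (c + k * θ + 1) := by
  have : 0 ≤ (k : ℝ) * θ := by positivity
  exact Real.Gamma_pos_of_pos (by linarith)

lemma degree_jacobiTransform {s c θ : ℝ} (hs : 0 < s) (hθ : 0 < θ) (hc : -1 < c) (n : ℕ) :
    (jacobiTransform s c θ n).degree = n := by
  refine Polynomial.degree_eq_of_le_of_coeff_ne_zero ?_ ?_
  · rw [Polynomial.degree_le_iff_coeff_zero]
    intro m hm
    rw [coeff_jacobiTransform, jacobiCoeff_eq_zero_of_lt s (by exact_mod_cast hm), zero_div]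
  · rw [coeff_jacobiTransform, jacobiCoeff, Nat.choose_self]
    have h1 : ∏ j ∈ Finset.range n, (s + n + (j : ℝ)) ≠ 0 :=
      Finset.prod_ne_zero_iff.2 fun j _ => by positivity
    have h2 := (Gamma_shift_pos hθ hc n).ne'
    have h3 : (n.factorial : ℝ) ≠ 0 := by positivity
    simp [h1, h2, h3]

lemma alpha_add_one_pos {a b θ : ℝ} (hθ : 0 < θ) (hab : 0 < a + b + 1) :
    0 < alpha a b θ + 1 := by
  unfold alpha
  have : 0 < (a + b + 1) / θ := by positivity
  linarith

lemma theta_mul_alpha_add_one {a b θ : ℝ} (hθ : 0 < θ) :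
    θ * (alpha a b θ + 1) = a + b + 1 := by
  unfold alpha
  field_simp
  ring

lemma h_div_eq {a b θ : ℝ} (hθ : 0 < θ) (n : ℕ) :
    h a b θ n / θ = 1 / (θ * (2 * n + (alpha a b θ + 1))) := by
  have := theta_mul_alpha_add_one (a := a) (b := b) hθ
  rw [mul_add, this, h, div_right_comm, div_self hθ.ne']
  congr 1
  ring

lemma div_h_eq {a b θ : ℝ} (hθ : 0 < θ) (n : ℕ) :
    θ / h a b θ n = θ * (2 * n + (alpha a b θ + 1)) := by
  rw [← inv_div, h_div_eq hθ, one_div, inv_inv]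

/-- The pairing is the Cauchy matrix form on normalised coefficients. -/
lemma pairing_eq_cauchy {a b θ : ℝ} (hθ : 0 < θ) (ha : -1 < a) (hb : -1 < b)
    (hab : 0 < a + b + 1) {P Q : Polynomial ℝ} {M N : ℕ} (hP : P.natDegree < M)
    (hQ : Q.natDegree < N) :
    pairing a b θ P Q = ∑ i ∈ Finset.range M, ∑ j ∈ Finset.range N,
      (P.coeff i * Real.Gamma (a + i * θ + 1)) * (Q.coeff j * Real.Gamma (b + j * θ + 1)) /
        (θ * (alpha a b θ + 1 + i + j)) := by
  rw [pairing_eq_sum hθ ha hb hab hP hQ]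
  refine Finset.sum_congr rfl fun i _ => Finset.sum_congr rfl fun j _ => ?_
  rw [show θ * (alpha a b θ + 1 + i + j) = a + b + 1 + (i + j) * θ by
    rw [← theta_mul_alpha_add_one hθ]; ring]
  ring

/-- The Gamma denominators of the coefficients cancel the Gamma factors of the moments, and Jacobi
orthogonality remains. The Cauchy matrix is symmetric, so one Jacobi family serves both sides. -/
lemma isBiorthogonal_jacobiTransform {a b θ : ℝ} (hθ : 0 < θ) (ha : -1 < a) (hb : -1 < b)
    (hab : 0 < a + b + 1) :
    IsBiorthogonal a b θ (jacobiTransform (alpha a b θ + 1) a θ)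
      (jacobiTransform (alpha a b θ + 1) b θ) := by
  have hs := alpha_add_one_pos hθ hab
  refine ⟨degree_jacobiTransform hs hθ ha, degree_jacobiTransform hs hθ hb, fun n m => ?_⟩
  have hn : ∀ (c : ℝ) (_ : -1 < c) (n : ℕ),
      (jacobiTransform (alpha a b θ + 1) c θ n).natDegree < n + 1 := fun c hc n => by
    rw [Polynomial.natDegree_eq_of_degree_eq_some (degree_jacobiTransform hs hθ hc n)]
    exact Nat.lt_succ_self n
  rw [pairing_eq_cauchy hθ ha hb hab (hn a ha n) (hn b hb m)]
  have h1 := sum_sum_jacobiCoeff hs (Nat.lt_succ_self n) (Nat.lt_succ_self m)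
  calc _ = θ⁻¹ * ∑ i ∈ Finset.range (n + 1), ∑ j ∈ Finset.range (m + 1),
        jacobiCoeff (alpha a b θ + 1) n i * jacobiCoeff (alpha a b θ + 1) m j /
          (alpha a b θ + 1 + i + j) := by
        rw [Finset.mul_sum]
        refine Finset.sum_congr rfl fun i _ => ?_
        rw [Finset.mul_sum]
        refine Finset.sum_congr rfl fun j _ => ?_
        rw [coeff_jacobiTransform, coeff_jacobiTransform,
          div_mul_cancel₀ _ (Gamma_shift_pos hθ ha i).ne',
          div_mul_cancel₀ _ (Gamma_shift_pos hθ hb j).ne']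
        field_simp
    _ = _ := by
        rw [h1, h_div_eq hθ]
        split_ifs
        · field_simp
        · simp

/-- The matrix of coefficients of a Christoffel–Darboux kernel does not depend on the chosen
biorthogonal system. -/
lemma sum_coeff_mul_coeff_eq {N : ℕ} {C A B A' B' : Matrix (Fin N) (Fin N) ℝ} {d : Fin N → ℝ}
    (hd : ∀ n, d n ≠ 0) (hAB : A * C * B.transpose = Matrix.diagonal d)
    (hAB' : A' * C * B'.transpose = Matrix.diagonal d) (k l : Fin N) :
    ∑ n, (d n)⁻¹ * A n k * B n l = ∑ n, (d n)⁻¹ * A' n k * B' n l := by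
  -- A one-sided inverse of a square matrix is two-sided, so `A C Bᵀ = D` forces `Bᵀ D⁻¹ A = C⁻¹`,
  -- in which the choice of `A` and `B` no longer appears.
  have key : ∀ {A B : Matrix (Fin N) (Fin N) ℝ}, A * C * B.transpose = Matrix.diagonal d →
      C * (B.transpose * Matrix.diagonal (fun n => (d n)⁻¹) * A) = 1 := by
    intro A B hAB
    have h1 : A * (C * B.transpose * Matrix.diagonal fun n => (d n)⁻¹) = 1 := by
      rw [← Matrix.mul_assoc, ← Matrix.mul_assoc, hAB, Matrix.diagonal_mul_diagonal]
      simp [hd]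
    rw [mul_eq_one_comm] at h1
    simpa only [Matrix.mul_assoc] using h1
  have h1 := key hAB
  have h2 := key hAB'
  have h3 : B.transpose * Matrix.diagonal (fun n => (d n)⁻¹) * A =
      B'.transpose * Matrix.diagonal (fun n => (d n)⁻¹) * A' := by
    rw [mul_eq_one_comm] at h1
    calc _ = (B.transpose * Matrix.diagonal (fun n => (d n)⁻¹) * A) *
          (C * (B'.transpose * Matrix.diagonal (fun n => (d n)⁻¹) * A')) := by
          rw [h2, Matrix.mul_one]
      _ = _ := by rw [← Matrix.mul_assoc, h1, Matrix.one_mul]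
  have h4 := congrFun (congrFun h3 l) k
  simp only [Matrix.mul_apply (M := _ * _), Matrix.mul_diagonal, Matrix.transpose_apply] at h4
  calc _ = ∑ n, B n l * (d n)⁻¹ * A n k := Finset.sum_congr rfl fun n _ => by ring
    _ = _ := h4
    _ = _ := Finset.sum_congr rfl fun n _ => by ring

lemma IsBiorthogonal.matrix_eq {a b θ : ℝ} (hθ : 0 < θ) (ha : -1 < a) (hb : -1 < b)
    (hab : 0 < a + b + 1) {P Q : ℕ → Polynomial ℝ} (hPQ : IsBiorthogonal a b θ P Q) (N : ℕ) :
    (Matrix.of fun n k : Fin N => (P n).coeff k * Real.Gamma (a + (k : ℕ) * θ + 1)) *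
      (Matrix.of fun i j : Fin N => 1 / (θ * (alpha a b θ + 1 + (i : ℕ) + (j : ℕ)))) *
      (Matrix.of fun n k : Fin N => (Q n).coeff k * Real.Gamma (b + (k : ℕ) * θ + 1)).transpose =
    Matrix.diagonal fun n : Fin N => h a b θ n / θ := by
  ext n m
  have hP : (P n).natDegree < N := by
    rw [Polynomial.natDegree_eq_of_degree_eq_some (hPQ.degree_left n)]; exact n.2
  have hQ : (Q m).natDegree < N := by
    rw [Polynomial.natDegree_eq_of_degree_eq_some (hPQ.degree_right m)]; exact m.2
  have h1 := hPQ.biorthogonal n m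
  rw [pairing_eq_cauchy hθ ha hb hab hP hQ] at h1
  simp only [Finset.sum_range] at h1
  rw [Matrix.diagonal_apply]
  simp only [Fin.ext_iff]
  rw [← h1, Finset.sum_comm]
  simp only [Matrix.mul_apply, Matrix.of_apply, Matrix.transpose_apply]
  refine Finset.sum_congr rfl fun j _ => ?_
  rw [Finset.sum_mul]
  refine Finset.sum_congr rfl fun i _ => ?_
  ring

/-- The Christoffel–Darboux kernel of any biorthogonal system. -/
lemma IsBiorthogonal.cdKernel_eq {a b θ : ℝ} (hθ : 0 < θ) (ha : -1 < a) (hb : -1 < b)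
    (hab : 0 < a + b + 1) {P Q : ℕ → Polynomial ℝ} (hPQ : IsBiorthogonal a b θ P Q) (N : ℕ)
    (x y : ℝ) :
    cdKernel a b θ P Q N x y = θ * ∑ k ∈ Finset.range N, ∑ l ∈ Finset.range N,
      kernelFactor (alpha a b θ + 1) k N * kernelFactor (alpha a b θ + 1) l N /
        (alpha a b θ + 1 + k + l) *
        ((x ^ θ) ^ k / Real.Gamma (a + k * θ + 1)) * ((y ^ θ) ^ l / Real.Gamma (b + l * θ + 1)) := by
  have hs := alpha_add_one_pos hθ hab
  have hd : ∀ n : Fin N, h a b θ n / θ ≠ 0 := fun n => by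
    rw [h_div_eq hθ]; positivity
  have hm := sum_coeff_mul_coeff_eq hd (hPQ.matrix_eq hθ ha hb hab N)
    ((isBiorthogonal_jacobiTransform hθ ha hb hab).matrix_eq hθ ha hb hab N)
  -- By the independence `hm`, the coefficients can be computed from the explicit Jacobi system,
  -- where the sum is known.
  have hcoef : ∀ k ∈ Finset.range N, ∀ l ∈ Finset.range N,
      ∑ n ∈ Finset.range N, θ / h a b θ n * ((P n).coeff k * Real.Gamma (a + k * θ + 1)) *
        ((Q n).coeff l * Real.Gamma (b + l * θ + 1)) =
      θ * (kernelFactor (alpha a b θ + 1) k N * kernelFactor (alpha a b θ + 1) l N /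
        (alpha a b θ + 1 + k + l)) := by
    intro k hk l hl
    have h1 := hm ⟨k, Finset.mem_range.1 hk⟩ ⟨l, Finset.mem_range.1 hl⟩
    simp only [Matrix.of_apply, coeff_jacobiTransform, inv_div] at h1
    rw [← Finset.sum_range (fun n => θ / h a b θ n * ((P n).coeff k * Real.Gamma (a + k * θ + 1)) *
        ((Q n).coeff l * Real.Gamma (b + l * θ + 1)))] at h1
    rw [h1, ← sum_jacobiCoeff_mul hs, Finset.mul_sum, Finset.sum_range]
    refine Finset.sum_congr rfl fun n _ => ?_
    rw [div_mul_cancel₀ _ (Gamma_shift_pos hθ ha k).ne',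
      div_mul_cancel₀ _ (Gamma_shift_pos hθ hb l).ne', div_h_eq hθ]
    ring
  have hlt : ∀ {R : ℕ → Polynomial ℝ} (_ : ∀ n, (R n).degree = n) {n : ℕ}
      (_ : n ∈ Finset.range N), (R n).natDegree < N := fun hR n hn => by
    rw [Polynomial.natDegree_eq_of_degree_eq_some (hR n)]; exact Finset.mem_range.1 hn
  calc cdKernel a b θ P Q N x y
      = ∑ n ∈ Finset.range N, ∑ k ∈ Finset.range N, ∑ l ∈ Finset.range N,
        (θ / h a b θ n * ((P n).coeff k * Real.Gamma (a + k * θ + 1)) *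
          ((Q n).coeff l * Real.Gamma (b + l * θ + 1))) *
        (((x ^ θ) ^ k / Real.Gamma (a + k * θ + 1)) *
          ((y ^ θ) ^ l / Real.Gamma (b + l * θ + 1))) := by
        refine Finset.sum_congr rfl fun n hn => ?_
        rw [Polynomial.eval_eq_sum_range' (hlt hPQ.degree_left hn),
          Polynomial.eval_eq_sum_range' (hlt hPQ.degree_right hn), mul_assoc, Finset.sum_mul_sum,
          Finset.mul_sum]
        refine Finset.sum_congr rfl fun k _ => ?_
        rw [Finset.mul_sum]
        refine Finset.sum_congr rfl fun l _ => ?_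
        have h1 := (Gamma_shift_pos hθ ha k).ne'
        have h2 := (Gamma_shift_pos hθ hb l).ne'
        generalize Real.Gamma (a + k * θ + 1) = g1 at *
        generalize Real.Gamma (b + l * θ + 1) = g2 at *
        field_simp
    _ = ∑ k ∈ Finset.range N, ∑ l ∈ Finset.range N, ∑ n ∈ Finset.range N,
        (θ / h a b θ n * ((P n).coeff k * Real.Gamma (a + k * θ + 1)) *
          ((Q n).coeff l * Real.Gamma (b + l * θ + 1))) *
        (((x ^ θ) ^ k / Real.Gamma (a + k * θ + 1)) *
          ((y ^ θ) ^ l / Real.Gamma (b + l * θ + 1))) := by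
        rw [Finset.sum_comm]
        exact Finset.sum_congr rfl fun k _ => Finset.sum_comm
    _ = _ := by
        rw [Finset.mul_sum]
        refine Finset.sum_congr rfl fun k hk => ?_
        rw [Finset.mul_sum]
        refine Finset.sum_congr rfl fun l hl => ?_
        rw [← Finset.sum_mul, hcoef k hk l hl]
        ring

end Kernel

/-! ### Decay of 1/Γ and of the Mellin–Barnes integrand -/

section GammaBounds

/-- The reciprocal Gamma function decays faster than any exponential in right half strips. -/
lemma exists_norm_inv_Gamma_le (L x₀ B : ℝ) :
    ∃ M : ℝ, 0 ≤ M ∧ ∀ w : ℂ, x₀ ≤ w.re → |w.im| ≤ B →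
      ‖(Complex.Gamma w)⁻¹‖ ≤ M * Real.exp (-L * w.re) := by
  -- Beyond `T` one has `‖w - 1‖ ≥ e^L`, so each use of `Γ(w) = (w-1) Γ(w-1)` gains at least
  -- `e^{-L}`, and `w - 1` stays to the right of `x₀`. Compactness handles the rectangle up to `T`.
  set T : ℝ := max (x₀ + 1) (Real.exp L + 1) with hT
  have hcont : Continuous fun w : ℂ => ‖(Complex.Gamma w)⁻¹‖ * Real.exp (L * w.re) := by
    have := Complex.differentiable_one_div_Gamma.continuous
    fun_prop
  obtain ⟨M, hM⟩ := (isCompact_Icc.reProdIm isCompact_Icc :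
    IsCompact (Icc x₀ T ×ℂ Icc (-B) B)).bddAbove_image hcont.continuousOn
  have hM' : ∀ w : ℂ, x₀ ≤ w.re → w.re ≤ T → |w.im| ≤ B →
      ‖(Complex.Gamma w)⁻¹‖ * Real.exp (L * w.re) ≤ M := fun w h1 h2 h3 =>
    hM (mem_image_of_mem _ (Complex.mem_reProdIm.2 ⟨⟨h1, h2⟩, abs_le.1 h3⟩))
  have hind : ∀ n : ℕ, ∀ w : ℂ, x₀ ≤ w.re → w.re ≤ T + n → |w.im| ≤ B →
      ‖(Complex.Gamma w)⁻¹‖ * Real.exp (L * w.re) ≤ M := by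
    intro n
    induction n with
    | zero => intro w h1 h2 h3; exact hM' w h1 (by simpa using h2) h3
    | succ n ih =>
      intro w h1 h2 h3
      rcases le_or_gt w.re (T + n) with h4 | h4
      · exact ih w h1 h4 h3
      have hn : (0 : ℝ) ≤ n := by positivity
      have hx : x₀ + 1 ≤ T := le_max_left _ _
      have hL : Real.exp L + 1 ≤ T := le_max_right _ _
      have hLp := Real.exp_pos L
      push_cast at h2
      have hre : (w - 1).re = w.re - 1 := by simp
      have him : (w - 1).im = w.im := by simp
      have h5 := ih (w - 1) (by rw [hre]; linarith) (by rw [hre]; linarith) (by rwa [him])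
      have hnorm : Real.exp L ≤ ‖w - 1‖ := by
        refine le_trans ?_ (Complex.re_le_norm _)
        rw [hre]; linarith
      have hne : w - 1 ≠ 0 := by
        intro h0
        rw [h0, norm_zero] at hnorm
        linarith
      have hG : Complex.Gamma w = (w - 1) * Complex.Gamma (w - 1) := by
        rw [← Complex.Gamma_add_one _ hne, sub_add_cancel]
      have hwpos : 0 < ‖w - 1‖ := norm_pos_iff.2 hne
      rw [hG, mul_inv, norm_mul, norm_inv (w - 1)]
      rw [hre] at h5
      have he : Real.exp (L * w.re) = Real.exp L * Real.exp (L * (w.re - 1)) := by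
        rw [← Real.exp_add]; congr 1; ring
      have hle : ‖w - 1‖⁻¹ * Real.exp L ≤ 1 := by
        rw [inv_mul_le_iff₀ hwpos, mul_one]; exact hnorm
      calc ‖w - 1‖⁻¹ * ‖(Complex.Gamma (w - 1))⁻¹‖ * Real.exp (L * w.re)
          = (‖w - 1‖⁻¹ * Real.exp L) *
            (‖(Complex.Gamma (w - 1))⁻¹‖ * Real.exp (L * (w.re - 1))) := by rw [he]; ring
        _ ≤ 1 * (‖(Complex.Gamma (w - 1))⁻¹‖ * Real.exp (L * (w.re - 1))) := by gcongr
        _ ≤ M := by rw [one_mul]; exact h5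
  -- `M` may be negative when `B < 0`, since the rectangle is then empty.
  refine ⟨max M 0, le_max_right _ _, fun w h1 h2 => ?_⟩
  obtain ⟨n, hn⟩ := exists_nat_ge (w.re - T)
  have h3 := hind n w h1 (by linarith) h2
  rw [neg_mul, Real.exp_neg, ← div_eq_mul_inv, le_div_iff₀ (Real.exp_pos _)]
  exact h3.trans (le_max_left _ _)

lemma norm_sq_sin_add_mul_I (x y : ℝ) :
    ‖Complex.sin (x + y * Complex.I)‖ ^ 2 = Real.sin x ^ 2 + Real.sinh y ^ 2 := by
  rw [Complex.sin_add_mul_I, ← Complex.ofReal_sin, ← Complex.ofReal_cos, ← Complex.ofReal_sinh,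
    ← Complex.ofReal_cosh, ← Complex.ofReal_mul, ← Complex.ofReal_mul, Complex.sq_norm,
    Complex.normSq_add_mul_I, mul_pow, mul_pow, Real.cosh_sq]
  linear_combination Real.sinh y ^ 2 * Real.sin_sq_add_cos_sq x

lemma norm_inv_sin_le_of_im {x y : ℝ} (hy : y ≠ 0) :
    Complex.sin (Real.pi * (x + y * Complex.I)) ≠ 0 ∧
    ‖(Complex.sin (Real.pi * (x + y * Complex.I)))⁻¹‖ ≤ |Real.sinh (Real.pi * y)|⁻¹ := by
  have h0 : Real.sinh (Real.pi * y) ≠ 0 := by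
    rw [Ne, Real.sinh_eq_zero]
    exact mul_ne_zero Real.pi_ne_zero hy
  have h1 := norm_sq_sin_add_mul_I (Real.pi * x) (Real.pi * y)
  have h2 : (Real.pi * (x + y * Complex.I) : ℂ) =
      (Real.pi * x : ℝ) + (Real.pi * y : ℝ) * Complex.I := by push_cast; ring
  rw [← h2] at h1
  have h3 : |Real.sinh (Real.pi * y)| ≤ ‖Complex.sin (Real.pi * (x + y * Complex.I))‖ := by
    refine abs_le_of_sq_le_sq ?_ (norm_nonneg _)
    rw [h1]
    nlinarith [sq_nonneg (Real.sin (Real.pi * x))]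
  have h4 : 0 < |Real.sinh (Real.pi * y)| := abs_pos.2 h0
  refine ⟨norm_pos_iff.1 (h4.trans_le h3), ?_⟩
  rw [norm_inv]
  exact inv_anti₀ h4 h3

/-- Midway between two zeros of `sin(πu)` the real part contributes `sin² = 1`; these vertical lines
are the ones along which the contour is shifted. -/
lemma norm_inv_sin_le_of_re (n : ℕ) (y : ℝ) :
    Complex.sin (Real.pi * ((1 / 2 - n : ℝ) + y * Complex.I)) ≠ 0 ∧
    ‖(Complex.sin (Real.pi * ((1 / 2 - n : ℝ) + y * Complex.I)))⁻¹‖ ≤ 1 := by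
  have h1 := norm_sq_sin_add_mul_I (Real.pi * (1 / 2 - n : ℝ)) (Real.pi * y)
  have h2 : (Real.pi * ((1 / 2 - n : ℝ) + y * Complex.I) : ℂ) =
      (Real.pi * (1 / 2 - n : ℝ) : ℝ) + (Real.pi * y : ℝ) * Complex.I := by push_cast; ring
  rw [← h2] at h1
  have hs : Real.sin (Real.pi * (1 / 2 - n : ℝ)) ^ 2 = 1 := by
    rw [show Real.pi * (1 / 2 - n : ℝ) = Real.pi / 2 - n * Real.pi by ring, Real.sin_pi_div_two_sub,
      Real.cos_nat_mul_pi, ← pow_mul, mul_comm, pow_mul]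
    simp
  have h3 : 1 ≤ ‖Complex.sin (Real.pi * ((1 / 2 - n : ℝ) + y * Complex.I))‖ := by
    rw [hs] at h1
    nlinarith [sq_nonneg (Real.sinh (Real.pi * y)),
      norm_nonneg (Complex.sin (Real.pi * ((1 / 2 - n : ℝ) + y * Complex.I)))]
  refine ⟨norm_pos_iff.1 (one_pos.trans_le h3), ?_⟩
  rw [norm_inv]
  exact inv_le_one_of_one_le₀ h3

/-- The reflection formula `Γ(u) = π / (sin(πu) Γ(1-u))` trades `Γ` on the left for `1/Γ` on the
right. The bound `S` on `1/sin` keeps `u` away from the poles. -/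
lemma exists_norm_gIntegrand_le {θ : ℝ} (hθ : 0 < θ) (α c δ B S : ℝ) {z : ℂ} (hz : z ≠ 0) :
    ∃ C : ℝ, 0 ≤ C ∧ ∀ u : ℂ, u.re ≤ δ → |u.im| ≤ B → Complex.sin (Real.pi * u) ≠ 0 →
      ‖(Complex.sin (Real.pi * u))⁻¹‖ ≤ S → ‖gIntegrand θ α c z u‖ ≤ C * Real.exp u.re := by
  -- The decay `e^{L Re u}` of `1/Γ(1-u)` absorbs the factor `‖z‖^{-Re u}` and leaves exactly `e^{Re
  -- u}`. For the other two reciprocal Gammas boundedness, `L = 0`, is enough.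
  set L : ℝ := Real.log ‖z‖ + 1 with hL
  obtain ⟨M₁, hM₁0, hM₁⟩ := exists_norm_inv_Gamma_le L (1 - δ) B
  obtain ⟨M₂, hM₂0, hM₂⟩ := exists_norm_inv_Gamma_le 0 (α - δ + 1) B
  obtain ⟨M₃, hM₃0, hM₃⟩ := exists_norm_inv_Gamma_le 0 (c - θ * δ + 1) (θ * B)
  have hpi := Real.pi_pos
  refine ⟨Real.pi * |S| * M₁ * Real.exp (-L) * Real.exp (Real.pi * B) * M₂ * M₃, by positivity,
    fun u h1 h2 h3 h4 => ?_⟩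
  have hG : Complex.Gamma u =
      Real.pi * (Complex.sin (Real.pi * u))⁻¹ * (Complex.Gamma (1 - u))⁻¹ := by
    have hr := Complex.Gamma_mul_Gamma_one_sub u
    have hne : Complex.Gamma (1 - u) ≠ 0 := by
      intro h0
      rw [h0, mul_zero, eq_comm, div_eq_zero_iff] at hr
      rcases hr with hr | hr
      · exact Real.pi_ne_zero (by exact_mod_cast hr)
      · exact h3 hr
    rw [eq_mul_inv_iff_mul_eq₀ hne, hr, div_eq_mul_inv]
  have b1 := hM₁ (1 - u) (by simp; linarith) (by simpa using h2)
  have b2 := hM₂ (α - u + 1) (by simp; linarith) (by simpa using h2)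
  have b3 := hM₃ (c - θ * u + 1) (by simp; nlinarith) (by
    simp only [Complex.add_im, Complex.sub_im, Complex.ofReal_im, Complex.mul_im, Complex.ofReal_re,
      zero_mul, add_zero, zero_sub, Complex.one_im, abs_neg, abs_mul, abs_of_pos hθ]
    gcongr)
  simp only [neg_zero, zero_mul, Real.exp_zero, mul_one] at b2 b3
  have bz : ‖z ^ (-u)‖ ≤ Real.exp (-Real.log ‖z‖ * u.re) * Real.exp (Real.pi * B) := by
    rw [Complex.norm_cpow_of_ne_zero hz, div_eq_mul_inv, ← Real.exp_neg,
      Real.rpow_def_of_pos (norm_pos_iff.2 hz)]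
    have : -(z.arg * (-u).im) ≤ Real.pi * B := by
      rw [Complex.neg_im, mul_neg, neg_neg]
      calc z.arg * u.im ≤ |z.arg * u.im| := le_abs_self _
        _ = |z.arg| * |u.im| := abs_mul _ _
        _ ≤ Real.pi * B := by
          gcongr
          exact Complex.abs_arg_le_pi z
    have e : Real.log ‖z‖ * (-u).re = -Real.log ‖z‖ * u.re := by simp
    rw [e]
    gcongr
  have hre : (1 - u).re = 1 - u.re := by simp
  rw [hre] at b1
  have hexp : Real.exp (-L * (1 - u.re)) * Real.exp (-Real.log ‖z‖ * u.re) =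
      Real.exp (-L) * Real.exp u.re := by
    rw [← Real.exp_add, ← Real.exp_add]
    congr 1
    rw [hL]
    ring
  rw [gIntegrand, hG, div_eq_mul_inv, mul_inv]
  simp only [norm_mul]
  rw [Complex.norm_real, Real.norm_of_nonneg hpi.le]
  calc _ ≤ Real.pi * |S| * (M₁ * Real.exp (-L * (1 - u.re))) *
        (Real.exp (-Real.log ‖z‖ * u.re) * Real.exp (Real.pi * B)) * (M₂ * M₃) := by
        gcongr
        exact h4.trans (le_abs_self S)
    _ = Real.pi * |S| * M₁ * (Real.exp (-L * (1 - u.re)) * Real.exp (-Real.log ‖z‖ * u.re)) *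
        Real.exp (Real.pi * B) * M₂ * M₃ := by ring
    _ = _ := by rw [hexp]; ring

end GammaBounds

/-! ### Cauchy's integral formula on rectangles -/

section Rectangle

/-- The integral of `f` around the rectangle `[x₁, x₂] × [y₁, y₂]`. -/
noncomputable def rectIntegral (f : ℂ → ℂ) (x₁ x₂ y₁ y₂ : ℝ) : ℂ :=
  (∫ x in x₁..x₂, f (x + y₁ * Complex.I)) - (∫ x in x₁..x₂, f (x + y₂ * Complex.I)) +
    Complex.I * (∫ y in y₁..y₂, f (x₂ + y * Complex.I)) -
    Complex.I * ∫ y in y₁..y₂, f (x₁ + y * Complex.I)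

/-- The boundary of a rectangle. -/
def rectBoundary (x₁ x₂ y₁ y₂ : ℝ) : Set ℂ :=
  {u | u ∈ uIcc x₁ x₂ ×ℂ uIcc y₁ y₂ ∧ (u.re = x₁ ∨ u.re = x₂ ∨ u.im = y₁ ∨ u.im = y₂)}

lemma horizontal_mem_rectBoundary {x₁ x₂ y₁ y₂ x y : ℝ} (hx : x ∈ uIcc x₁ x₂)
    (hy : y = y₁ ∨ y = y₂) : (x + y * Complex.I : ℂ) ∈ rectBoundary x₁ x₂ y₁ y₂ := by
  refine ⟨Complex.mem_reProdIm.2 ⟨by simpa using hx, ?_⟩, ?_⟩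
  · rcases hy with rfl | rfl <;> simp
  · simp [hy]

lemma vertical_mem_rectBoundary {x₁ x₂ y₁ y₂ x y : ℝ} (hx : x = x₁ ∨ x = x₂)
    (hy : y ∈ uIcc y₁ y₂) : (x + y * Complex.I : ℂ) ∈ rectBoundary x₁ x₂ y₁ y₂ := by
  refine ⟨Complex.mem_reProdIm.2 ⟨?_, by simpa using hy⟩, ?_⟩
  · rcases hx with rfl | rfl <;> simp
  · rcases hx with rfl | rfl <;> simp

lemma rectIntegral_congr {f g : ℂ → ℂ} {x₁ x₂ y₁ y₂ : ℝ}
    (hfg : EqOn f g (rectBoundary x₁ x₂ y₁ y₂)) :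
    rectIntegral f x₁ x₂ y₁ y₂ = rectIntegral g x₁ x₂ y₁ y₂ := by
  unfold rectIntegral
  congr 1
  · congr 1
    · congr 1
      · exact intervalIntegral.integral_congr fun x hx =>
          hfg (horizontal_mem_rectBoundary hx (Or.inl rfl))
      · exact intervalIntegral.integral_congr fun x hx =>
          hfg (horizontal_mem_rectBoundary hx (Or.inr rfl))
    · congr 1
      exact intervalIntegral.integral_congr fun x hx =>
          hfg (vertical_mem_rectBoundary (Or.inr rfl) hx)
  · congr 1
    exact intervalIntegral.integral_congr fun x hx =>
          hfg (vertical_mem_rectBoundary (Or.inl rfl) hx)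

lemma intervalIntegrable_horizontal {f : ℂ → ℂ} {x₁ x₂ y₁ y₂ y : ℝ}
    (hf : ContinuousOn f (rectBoundary x₁ x₂ y₁ y₂)) (hy : y = y₁ ∨ y = y₂) :
    IntervalIntegrable (fun x : ℝ => f (x + y * Complex.I)) volume x₁ x₂ :=
  (hf.comp (by fun_prop) fun _ hx => horizontal_mem_rectBoundary hx hy).intervalIntegrable

lemma intervalIntegrable_vertical {f : ℂ → ℂ} {x₁ x₂ y₁ y₂ x : ℝ}
    (hf : ContinuousOn f (rectBoundary x₁ x₂ y₁ y₂)) (hx : x = x₁ ∨ x = x₂) :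
    IntervalIntegrable (fun y : ℝ => f (x + y * Complex.I)) volume y₁ y₂ :=
  (hf.comp (by fun_prop) fun _ hy => vertical_mem_rectBoundary hx hy).intervalIntegrable

lemma rectIntegral_add {f g : ℂ → ℂ} {x₁ x₂ y₁ y₂ : ℝ}
    (hf : ContinuousOn f (rectBoundary x₁ x₂ y₁ y₂))
    (hg : ContinuousOn g (rectBoundary x₁ x₂ y₁ y₂)) :
    rectIntegral (fun u => f u + g u) x₁ x₂ y₁ y₂ =
      rectIntegral f x₁ x₂ y₁ y₂ + rectIntegral g x₁ x₂ y₁ y₂ := by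
  unfold rectIntegral
  rw [intervalIntegral.integral_add (intervalIntegrable_horizontal hf (Or.inl rfl))
      (intervalIntegrable_horizontal hg (Or.inl rfl)),
    intervalIntegral.integral_add (intervalIntegrable_horizontal hf (Or.inr rfl))
      (intervalIntegrable_horizontal hg (Or.inr rfl)),
    intervalIntegral.integral_add (intervalIntegrable_vertical hf (Or.inl rfl))
      (intervalIntegrable_vertical hg (Or.inl rfl)),
    intervalIntegral.integral_add (intervalIntegrable_vertical hf (Or.inr rfl))
      (intervalIntegrable_vertical hg (Or.inr rfl))]
  ring

lemma rectIntegral_const_mul (r : ℂ) (f : ℂ → ℂ) (x₁ x₂ y₁ y₂ : ℝ) :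
    rectIntegral (fun u => r * f u) x₁ x₂ y₁ y₂ = r * rectIntegral f x₁ x₂ y₁ y₂ := by
  unfold rectIntegral
  simp only [intervalIntegral.integral_const_mul]
  ring

lemma log_sub_log_neg_of_im_pos {w : ℂ} (hw : 0 < w.im) :
    Complex.log w - Complex.log (-w) = Real.pi * Complex.I := by
  rw [Complex.log, Complex.log, norm_neg, Complex.arg_neg_eq_arg_sub_pi_of_im_pos hw]
  push_cast
  ring

lemma log_sub_log_neg_of_im_neg {w : ℂ} (hw : w.im < 0) :
    Complex.log w - Complex.log (-w) = -(Real.pi * Complex.I) := by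
  rw [Complex.log, Complex.log, norm_neg, Complex.arg_neg_eq_arg_add_pi_of_im_neg hw]
  push_cast
  ring

/-- `log(u-p)` is a primitive along three sides. The left side crosses the branch cut, so
`log(-(u-p))` is used there; the two branches differ by `±πi` at the left corners, and these jumps
add up to `2πi`. -/
lemma rectIntegral_inv_sub {x₁ x₂ y₁ y₂ p : ℝ} (h₁ : x₁ < p) (h₂ : p < x₂) (h₃ : y₁ < 0)
    (h₄ : 0 < y₂) :
    rectIntegral (fun u => (u - p)⁻¹) x₁ x₂ y₁ y₂ = 2 * Real.pi * Complex.I := by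
  have hne : ∀ u ∈ rectBoundary x₁ x₂ y₁ y₂, u - (p : ℂ) ≠ 0 := by
    rintro u ⟨-, hu⟩ h0
    have hu' : u = (p : ℂ) := sub_eq_zero.1 h0
    rw [hu'] at hu
    simp only [Complex.ofReal_re, Complex.ofReal_im] at hu
    rcases hu with hu | hu | hu | hu <;> linarith
  have hc : ContinuousOn (fun u : ℂ => (u - p)⁻¹) (rectBoundary x₁ x₂ y₁ y₂) :=
    ContinuousOn.inv₀ (by fun_prop) hne
  have hor : ∀ y : ℝ, y = y₁ ∨ y = y₂ → ∫ x in x₁..x₂, ((x + y * Complex.I : ℂ) - p)⁻¹ =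
      Complex.log (x₂ + y * Complex.I - p) - Complex.log (x₁ + y * Complex.I - p) := by
    intro y hy
    have hy0 : y ≠ 0 := by rcases hy with rfl | rfl <;> [exact h₃.ne; exact h₄.ne']
    refine intervalIntegral.integral_eq_sub_of_hasDerivAt
      (f := fun x : ℝ => Complex.log (x + y * Complex.I - p)) (fun x _ => ?_)
      (intervalIntegrable_horizontal hc hy)
    have hd : HasDerivAt (fun x : ℝ => (x + y * Complex.I - p : ℂ)) 1 x :=
      ((Complex.ofRealCLM.hasDerivAt).add_const _).sub_const _
    simpa using hd.clog_real (Or.inr (by simpa using hy0))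
  -- The sign `e` selects the branch: `1` on the right side, `-1` on the left.
  have vert : ∀ (x : ℝ) (e : ℂ), x = x₁ ∨ x = x₂ → (∀ y : ℝ, e * (x + y * Complex.I - p) ∈
      Complex.slitPlane) → e ≠ 0 → Complex.I * ∫ y in y₁..y₂, ((x + y * Complex.I : ℂ) - p)⁻¹ =
      Complex.log (e * (x + y₂ * Complex.I - p)) - Complex.log (e * (x + y₁ * Complex.I - p)) := by
    intro x e hx hs he
    rw [← intervalIntegral.integral_const_mul]
    refine intervalIntegral.integral_eq_sub_of_hasDerivAt
      (f := fun y : ℝ => Complex.log (e * (x + y * Complex.I - p))) (fun y _ => ?_)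
      ((intervalIntegrable_vertical hc hx).const_mul _)
    have hd : HasDerivAt (fun y : ℝ => e * (x + y * Complex.I - p : ℂ)) (e * (1 * Complex.I)) y :=
      ((((Complex.ofRealCLM.hasDerivAt).mul_const _).const_add _).sub_const _).const_mul _
    convert! hd.clog_real (hs y) using 1
    have : (x + y * Complex.I - p : ℂ) ≠ 0 := by
      intro h0
      have := hs y
      rw [h0, mul_zero] at this
      exact Complex.zero_notMem_slitPlane this
    field_simp
  have hr := vert x₂ 1 (Or.inr rfl) (fun y => Or.inl (by simpa using h₂)) one_ne_zero
  have hl := vert x₁ (-1) (Or.inl rfl) (fun y => Or.inl (by simpa using h₁)) (by simp)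
  have e1 := log_sub_log_neg_of_im_pos (w := x₁ + y₂ * Complex.I - p) (by simpa using h₄)
  have e2 := log_sub_log_neg_of_im_neg (w := x₁ + y₁ * Complex.I - p) (by simpa using h₃)
  rw [rectIntegral, hor y₁ (Or.inl rfl), hor y₂ (Or.inr rfl), hr, hl]
  simp only [one_mul, neg_one_mul]
  linear_combination e1 - e2

/-- Cauchy's integral formula for a rectangle. -/
lemma rectIntegral_div_sub {F : ℂ → ℂ} {U : Set ℂ} (hU : IsOpen U) (hF : DifferentiableOn ℂ F U)
    {x₁ x₂ y₁ y₂ p : ℝ} (hsub : uIcc x₁ x₂ ×ℂ uIcc y₁ y₂ ⊆ U) (h₁ : x₁ < p) (h₂ : p < x₂)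
    (h₃ : y₁ < 0) (h₄ : 0 < y₂) :
    rectIntegral (fun u => F u / (u - p)) x₁ x₂ y₁ y₂ = 2 * Real.pi * Complex.I * F p := by
  have hpU : (p : ℂ) ∈ U := hsub (Complex.mem_reProdIm.2
    ⟨by rw [uIcc_of_le (h₁.trans h₂).le]; exact ⟨by simpa using h₁.le, by simpa using h₂.le⟩,
      by rw [uIcc_of_le (h₃.trans h₄).le]; exact ⟨by simpa using h₃.le, by simpa using h₄.le⟩⟩)
  -- The difference quotient extends holomorphically across `p`, so it integrates to 0 and only
  -- `F(p)/(u-p)` contributes.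
  have hD : DifferentiableOn ℂ (dslope F p) U :=
    (Complex.differentiableOn_dslope (hU.mem_nhds hpU)).2 hF
  have hne : ∀ u ∈ rectBoundary x₁ x₂ y₁ y₂, u - (p : ℂ) ≠ 0 := by
    rintro u ⟨-, hu⟩ h0
    have hu' : u = (p : ℂ) := sub_eq_zero.1 h0
    rw [hu'] at hu
    simp only [Complex.ofReal_re, Complex.ofReal_im] at hu
    rcases hu with hu | hu | hu | hu <;> linarith
  have hc : ContinuousOn (fun u : ℂ => (u - p)⁻¹) (rectBoundary x₁ x₂ y₁ y₂) :=
    ContinuousOn.inv₀ (by fun_prop) hne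
  have hEq : EqOn (fun u => F u / (u - p)) (fun u => dslope F p u + F p * (u - p)⁻¹)
      (rectBoundary x₁ x₂ y₁ y₂) := by
    intro u hu
    have h0 := hne u hu
    simp only
    rw [dslope_of_ne _ (sub_ne_zero.1 h0), slope_def_field]
    field_simp
    ring
  have hzero : rectIntegral (dslope F p) x₁ x₂ y₁ y₂ = 0 := by
    have := Complex.integral_boundary_rect_eq_zero_of_differentiableOn (dslope F p)
      (x₁ + y₁ * Complex.I) (x₂ + y₂ * Complex.I) (by simpa using hD.mono hsub)
    simpa [rectIntegral] using this
  rw [rectIntegral_congr hEq, rectIntegral_add (hD.continuousOn.mono fun u hu => hsub hu.1)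
    (hc.const_mul (F p)), rectIntegral_const_mul, hzero, rectIntegral_inv_sub h₁ h₂ h₃ h₄]
  ring

end Rectangle

/-! ### The loop integral as a sum of residues -/

section Loop

/-- The entire factor `z^{-u} / (Γ(α-u+1) Γ(c-θu+1))` of the integrand. -/
noncomputable def gEntire (θ α c : ℝ) (z u : ℂ) : ℂ :=
  z ^ (-u) * (Complex.Gamma (α - u + 1))⁻¹ * (Complex.Gamma (c - θ * u + 1))⁻¹

/-- The coefficients of the power series of `gInf`. -/
noncomputable def gTerm (θ α c : ℝ) (z : ℂ) (k : ℕ) : ℂ :=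
  (-1) ^ k * z ^ k /
    ((k.factorial : ℂ) * Complex.Gamma ((α : ℂ) + k + 1) * Complex.Gamma ((c : ℂ) + θ * k + 1))

lemma gIntegrand_eq (θ α c : ℝ) (z u : ℂ) :
    gIntegrand θ α c z u = Complex.Gamma u * gEntire θ α c z u := by
  rw [gIntegrand, gEntire, div_eq_mul_inv, mul_inv]
  ring

lemma differentiable_gEntire (θ α c : ℝ) {z : ℂ} (hz : z ≠ 0) :
    Differentiable ℂ (gEntire θ α c z) := by
  have h1 : Differentiable ℂ fun u : ℂ => z ^ (-u) := fun u =>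
    (differentiableAt_id.neg).const_cpow (Or.inl hz)
  have h2 : Differentiable ℂ fun u : ℂ => (Complex.Gamma (α - u + 1))⁻¹ :=
    Complex.differentiable_one_div_Gamma.comp (by fun_prop)
  have h3 : Differentiable ℂ fun u : ℂ => (Complex.Gamma (c - θ * u + 1))⁻¹ :=
    Complex.differentiable_one_div_Gamma.comp (by fun_prop)
  exact (h1.mul h2).mul h3

lemma continuousOn_gIntegrand (θ α c : ℝ) {z : ℂ} (hz : z ≠ 0) :
    ContinuousOn (gIntegrand θ α c z) {u | ∀ m : ℕ, u ≠ -m} := by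
  intro u hu
  have : gIntegrand θ α c z = fun u => Complex.Gamma u * gEntire θ α c z u :=
    funext fun u => gIntegrand_eq θ α c z u
  rw [this]
  exact ((Complex.differentiableAt_Gamma u hu).continuousAt.mul
    (differentiable_gEntire θ α c hz u).continuousAt).continuousWithinAt

lemma ne_neg_natCast_of_im {u : ℂ} (hu : u.im ≠ 0) (m : ℕ) : u ≠ -m := by
  rintro rfl
  simp at hu

lemma Gamma_add_nat_eq_mul_prod {u : ℂ} {k : ℕ} (hu : ∀ j < k, u + j ≠ 0) :
    Complex.Gamma (u + k) = Complex.Gamma u * ∏ j ∈ Finset.range k, (u + j) := by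
  induction k with
  | zero => simp
  | succ k ih =>
    rw [Finset.prod_range_succ, ← mul_assoc, ← ih fun j hj => hu j (by omega), Nat.cast_succ,
      ← add_assoc, Complex.Gamma_add_one _ (hu k (by omega)), mul_comm]

/-- The residue of the integrand at `-k`. -/
lemma rectIntegral_gIntegrand (θ α c : ℝ) {z : ℂ} (hz : z ≠ 0) (k : ℕ) {x₁ x₂ y₁ y₂ : ℝ}
    (h₁ : -k - 1 < x₁) (h₁' : x₁ < -k) (h₂ : -k < x₂) (h₂' : k = 0 ∨ x₂ < -k + 1)
    (h₃ : y₁ < 0) (h₄ : 0 < y₂) :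
    rectIntegral (gIntegrand θ α c z) x₁ x₂ y₁ y₂ =
      2 * Real.pi * Complex.I * gTerm θ α c z k := by
  -- A region in which `-k` is the only pole of `Γ`; for `k = 0` there is no pole further right, so
  -- no right bound is imposed.
  let U : Set ℂ := {u | -k - 1 < u.re ∧ (k = 0 ∨ u.re < -k + 1)}
  have hU : IsOpen U := by
    have e : U = {u : ℂ | (-k - 1 : ℝ) < u.re} ∩ ({u : ℂ | k = 0} ∪ {u : ℂ | u.re < (-k + 1 : ℝ)}) := by
      ext u; rfl
    rw [e]
    exact (isOpen_lt continuous_const Complex.continuous_re).inter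
      (isOpen_const.union (isOpen_lt Complex.continuous_re continuous_const))
  have hne : ∀ u ∈ U, ∀ j < k, u + (j : ℂ) ≠ 0 := by
    rintro u ⟨-, hu⟩ j hj h0
    have hk : u.re < -k + 1 := hu.resolve_left (by omega)
    have hre : u.re + j = 0 := by simpa using congrArg Complex.re h0
    have : (j : ℝ) + 1 ≤ k := by exact_mod_cast hj
    linarith
  -- From `Γ(u+k+1) = Γ(u) (∏_{j<k} (u+j)) (u+k)`: this is the integrand multiplied by `u + k`, with
  -- the singularity at `-k` removed.
  let F : ℂ → ℂ := fun u =>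
    Complex.Gamma (u + k + 1) * gEntire θ α c z u / ∏ j ∈ Finset.range k, (u + j)
  have hF : DifferentiableOn ℂ F U := by
    intro u hu
    refine DifferentiableAt.differentiableWithinAt ?_
    refine DifferentiableAt.fun_div (DifferentiableAt.fun_mul ?_ (differentiable_gEntire θ α c hz u)) ?_
      (Finset.prod_ne_zero_iff.2 fun j hj => hne u hu j (Finset.mem_range.1 hj))
    · refine DifferentiableAt.comp (f := fun u : ℂ => u + k + 1) u
        (Complex.differentiableAt_Gamma _ fun m hm => ?_) (by fun_prop)
      have := congrArg Complex.re hm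
      simp at this
      have := hu.1
      have hm0 : (0 : ℝ) ≤ m := by positivity
      linarith
    · fun_prop
  have hsub : uIcc x₁ x₂ ×ℂ uIcc y₁ y₂ ⊆ U := by
    intro u hu
    rw [Complex.mem_reProdIm, uIcc_of_le (h₁'.trans h₂).le] at hu
    exact ⟨h₁.trans_le hu.1.1, h₂'.imp_right fun h => hu.1.2.trans_lt h⟩
  have hEq : EqOn (gIntegrand θ α c z) (fun u => F u / (u - ((-k : ℝ) : ℂ)))
      (rectBoundary x₁ x₂ y₁ y₂) := by
    intro u hu
    have huU := hsub hu.1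
    have huk : u + k ≠ 0 := by
      intro h0
      obtain ⟨-, hu⟩ := hu
      have hre : u.re + k = 0 := by simpa using congrArg Complex.re h0
      have him : u.im = 0 := by simpa using congrArg Complex.im h0
      rcases hu with hu | hu | hu | hu <;> linarith
    have hG : Complex.Gamma (u + k + 1) =
        Complex.Gamma u * (∏ j ∈ Finset.range k, (u + j)) * (u + k) := by
      rw [Complex.Gamma_add_one _ huk, Gamma_add_nat_eq_mul_prod (hne u huU)]
      ring
    have hp : ∏ j ∈ Finset.range k, (u + (j : ℂ)) ≠ 0 :=
      Finset.prod_ne_zero_iff.2 fun j hj => hne u huU j (Finset.mem_range.1 hj)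
    simp only [F]
    rw [gIntegrand_eq, hG]
    push_cast
    rw [sub_neg_eq_add]
    field_simp
  rw [rectIntegral_congr hEq, rectIntegral_div_sub hU hF hsub h₁' h₂ h₃ h₄]
  congr 1
  have hprod : ∏ j ∈ Finset.range k, ((-k : ℂ) + j) = (-1) ^ k * k.factorial := by
    rw [← prod_range_cast_sub]
    exact Finset.prod_congr rfl fun j _ => by ring
  have hsq : ((-1 : ℂ) ^ k)⁻¹ = (-1) ^ k := by
    rw [← inv_pow]; norm_num
  simp only [F, gEntire, gTerm]
  push_cast
  rw [hprod, neg_neg, Complex.cpow_natCast, neg_add_cancel, zero_add, Complex.Gamma_one,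
    sub_neg_eq_add, mul_neg, sub_neg_eq_add]
  simp only [div_eq_mul_inv, mul_inv, hsq]
  ring

namespace LeftLoop

/-- The loop with the same horizontal edges and the vertical edge at `x`. -/
def withRight (γ : LeftLoop) (x : ℝ) : LeftLoop := { γ with right := x }

/-- The horizontal tails cancel, leaving the boundary of the rectangle between the two vertical
edges. -/
lemma integral_sub_integral_withRight (γ : LeftLoop) {f : ℂ → ℂ} (hf : γ.Integrable f) {x : ℝ}
    (hx : x ≤ γ.right) :
    γ.integral f - (γ.withRight x).integral f =
      (2 * Real.pi * Complex.I)⁻¹ * rectIntegral f x γ.right γ.lower γ.upper := by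
  have hl := intervalIntegral.integral_Iic_sub_Iic (hf.1.mono_set (Iic_subset_Iic.2 hx)) hf.1
  have hu := intervalIntegral.integral_Iic_sub_Iic (hf.2.2.mono_set (Iic_subset_Iic.2 hx)) hf.2.2
  simp only [integral, rectIntegral, withRight]
  rw [← hl, ← hu]
  ring

lemma norm_integral_le (γ : LeftLoop) {f : ℂ → ℂ} {C : ℝ}
    (hl : ∀ x ≤ γ.right, ‖f (x + γ.lower * Complex.I)‖ ≤ C * Real.exp x)
    (hu : ∀ x ≤ γ.right, ‖f (x + γ.upper * Complex.I)‖ ≤ C * Real.exp x)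
    (hv : ∀ y ∈ Icc γ.lower γ.upper, ‖f (γ.right + y * Complex.I)‖ ≤ C * Real.exp γ.right) :
    ‖γ.integral f‖ ≤ ‖(2 * Real.pi * Complex.I : ℂ)⁻¹‖ *
      (C * (2 + (γ.upper - γ.lower)) * Real.exp γ.right) := by
  have hint : IntegrableOn (fun x : ℝ => C * Real.exp x) (Iic γ.right) :=
    (integrableOn_exp_Iic γ.right).const_mul C
  have hI : ∫ x in Iic γ.right, C * Real.exp x = C * Real.exp γ.right := by
    rw [integral_const_mul, integral_exp_Iic]
  have b1 : ‖∫ x in Iic γ.right, f (x + γ.lower * Complex.I)‖ ≤ C * Real.exp γ.right := by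
    rw [← hI]
    exact norm_integral_le_of_norm_le hint
      ((ae_restrict_iff' measurableSet_Iic).2 (Eventually.of_forall hl))
  have b2 : ‖∫ x in Iic γ.right, f (x + γ.upper * Complex.I)‖ ≤ C * Real.exp γ.right := by
    rw [← hI]
    exact norm_integral_le_of_norm_le hint
      ((ae_restrict_iff' measurableSet_Iic).2 (Eventually.of_forall hu))
  have b3 : ‖∫ y in γ.lower..γ.upper, f (γ.right + y * Complex.I)‖ ≤
      C * Real.exp γ.right * (γ.upper - γ.lower) := by
    have := intervalIntegral.norm_integral_le_of_norm_le_const (a := γ.lower) (b := γ.upper)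
      (f := fun y : ℝ => f (γ.right + y * Complex.I)) (C := C * Real.exp γ.right) (fun y hy => by
        rw [uIoc_of_le γ.lower_lt_upper.le] at hy
        exact hv y ⟨hy.1.le, hy.2⟩)
    rwa [abs_of_pos (sub_pos.2 γ.lower_lt_upper)] at this
  rw [integral, norm_mul]
  gcongr
  refine (norm_sub_le _ _).trans ?_
  refine (add_le_add (norm_add_le _ _) le_rfl).trans ?_
  rw [norm_mul, Complex.norm_I, one_mul]
  linarith

end LeftLoop

variable {γ : LeftLoop}

lemma im_abs_le {y : ℝ} (hy : y ∈ Icc γ.lower γ.upper) : |y| ≤ |γ.lower| + |γ.upper| := by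
  rw [abs_le]
  constructor
  · linarith [neg_abs_le γ.lower, hy.1, abs_nonneg γ.upper]
  · linarith [le_abs_self γ.upper, hy.2, abs_nonneg γ.lower]

/-- Exponential bound of the integrand on the horizontal edges of the loop and on the vertical
segments between the poles. -/
lemma exists_bound_on_loop {θ : ℝ} (hθ : 0 < θ) (α c : ℝ) {z : ℂ} (hz : z ≠ 0)
    (hl : γ.lower < 0) (hu : 0 < γ.upper) :
    ∃ C : ℝ, 0 ≤ C ∧
      (∀ x ≤ γ.right, ‖gIntegrand θ α c z (x + γ.lower * Complex.I)‖ ≤ C * Real.exp x) ∧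
      (∀ x ≤ γ.right, ‖gIntegrand θ α c z (x + γ.upper * Complex.I)‖ ≤ C * Real.exp x) ∧
      ∀ n : ℕ, 1 / 2 - (n : ℝ) ≤ γ.right → ∀ y ∈ Icc γ.lower γ.upper,
        ‖gIntegrand θ α c z ((1 / 2 - n : ℝ) + y * Complex.I)‖ ≤
          C * Real.exp (1 / 2 - n : ℝ) := by
  set S : ℝ := |Real.sinh (Real.pi * γ.lower)|⁻¹ + |Real.sinh (Real.pi * γ.upper)|⁻¹ + 1 with hS
  have i1 : 0 ≤ |Real.sinh (Real.pi * γ.lower)|⁻¹ := by positivity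
  have i2 : 0 ≤ |Real.sinh (Real.pi * γ.upper)|⁻¹ := by positivity
  obtain ⟨C, hC0, hC⟩ := exists_norm_gIntegrand_le hθ α c γ.right (|γ.lower| + |γ.upper|) S hz
  refine ⟨C, hC0, fun x hx => ?_, fun x hx => ?_, fun n hn y hy => ?_⟩
  · have hs := norm_inv_sin_le_of_im (x := x) hl.ne
    simpa using hC (x + γ.lower * Complex.I) (by simpa using hx)
      (by simp) hs.1 (hs.2.trans (by linarith))
  · have hs := norm_inv_sin_le_of_im (x := x) hu.ne'
    simpa using hC (x + γ.upper * Complex.I) (by simpa using hx)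
      (by simp) hs.1 (hs.2.trans (by linarith))
  · have hs := norm_inv_sin_le_of_re n y
    have hre : (((1 / 2 - n : ℝ) : ℂ) + y * Complex.I).re = 1 / 2 - n := by
      simp only [Complex.add_re, Complex.ofReal_re, Complex.mul_re, Complex.ofReal_im, Complex.I_re,
        Complex.I_im]
      ring
    have him : (((1 / 2 - n : ℝ) : ℂ) + y * Complex.I).im = y := by
      simp only [Complex.add_im, Complex.ofReal_re, Complex.mul_im, Complex.ofReal_im, Complex.I_re,
        Complex.I_im]
      ring
    have := hC ((1 / 2 - n : ℝ) + y * Complex.I) (by rw [hre]; exact hn)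
      (by rw [him]; exact im_abs_le hy) hs.1 (hs.2.trans (by linarith))
    rwa [hre] at this

lemma integrable_gIntegrand {θ : ℝ} (hθ : 0 < θ) (α c : ℝ) {z : ℂ} (hz : z ≠ 0)
    (hr : 0 < γ.right) (hl : γ.lower < 0) (hu : 0 < γ.upper) :
    γ.Integrable (gIntegrand θ α c z) := by
  obtain ⟨C, -, hCl, hCu, -⟩ := exists_bound_on_loop (γ := γ) hθ α c hz hl hu
  have hcont := continuousOn_gIntegrand θ α c hz
  have hhor : ∀ y : ℝ, y ≠ 0 → (∀ x ≤ γ.right,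
      ‖gIntegrand θ α c z (x + y * Complex.I)‖ ≤ C * Real.exp x) →
      IntegrableOn (fun x : ℝ => gIntegrand θ α c z (x + y * Complex.I)) (Iic γ.right) := by
    intro y hy hb
    refine Integrable.mono' ((integrableOn_exp_Iic γ.right).const_mul C) ?_
      ((ae_restrict_iff' measurableSet_Iic).2 (Eventually.of_forall hb))
    refine Continuous.aestronglyMeasurable ?_
    exact hcont.comp_continuous (by fun_prop) fun x => ne_neg_natCast_of_im (by simpa using hy)
  refine ⟨hhor _ hl.ne hCl, ?_, hhor _ hu.ne' hCu⟩
  refine Continuous.intervalIntegrable ?_ _ _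
  refine hcont.comp_continuous (by fun_prop) fun y m hm => ?_
  have hre := congrArg Complex.re hm
  simp at hre
  have : (0 : ℝ) ≤ m := by positivity
  linarith

lemma summable_norm_gTerm {θ : ℝ} (hθ : 0 < θ) (α c : ℝ) (z : ℂ) :
    Summable fun k => ‖gTerm θ α c z k‖ := by
  obtain ⟨M₁, hM₁0, hM₁⟩ := exists_norm_inv_Gamma_le 0 (α + 1) 0
  obtain ⟨M₂, hM₂0, hM₂⟩ := exists_norm_inv_Gamma_le 0 (c + 1) 0
  refine Summable.of_nonneg_of_le (fun k => norm_nonneg _) (fun k => ?_)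
    ((Real.summable_pow_div_factorial ‖z‖).mul_left (M₁ * M₂))
  have b1 := hM₁ (α + k + 1) (by simp) (by simp)
  have b2 := hM₂ (c + θ * k + 1) (by simp; positivity) (by simp)
  simp only [neg_zero, zero_mul, Real.exp_zero, mul_one] at b1 b2
  rw [gTerm, div_eq_mul_inv, mul_inv, mul_inv]
  simp only [norm_mul, norm_pow, norm_neg, norm_one, one_pow, one_mul, norm_inv (k.factorial : ℂ),
    Complex.norm_natCast]
  calc _ ≤ ‖z‖ ^ k * ((k.factorial : ℝ)⁻¹ * M₁ * M₂) := by gcongr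
    _ = _ := by ring

/-- The loop integral is the sum of the residues. -/
lemma hasSum_gTerm {θ : ℝ} (hθ : 0 < θ) (α c : ℝ) {z : ℂ} (hz : z ≠ 0)
    (hr : 0 < γ.right) (hl : γ.lower < 0) (hu : 0 < γ.upper) :
    HasSum (gTerm θ α c z) (gInf γ θ α c z) := by
  rw [(summable_norm_gTerm hθ α c z).of_norm.hasSum_iff_tendsto_nat]
  have hint := integrable_gIntegrand (γ := γ) hθ α c hz hr hl hu
  obtain ⟨C, hC0, hCl, hCu, hCv⟩ := exists_bound_on_loop (γ := γ) hθ α c hz hl hu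
  have hpi : (2 * Real.pi * Complex.I : ℂ) ≠ 0 := Complex.two_pi_I_ne_zero
  -- The vertical edge moves to `-n - 1/2`, halfway between the poles `-n` and `-n-1`, so the poles
  -- crossed are `0, …, -n`.
  have hstep : ∀ n : ℕ, ∑ k ∈ Finset.range (n + 1), gTerm θ α c z k =
      gInf γ θ α c z - (γ.withRight (1 / 2 - (n + 1 : ℕ))).integral (gIntegrand θ α c z) := by
    intro n
    induction n with
    | zero =>
      have h1 := γ.integral_sub_integral_withRight hint (x := 1 / 2 - (0 + 1 : ℕ))
        (by push_cast; linarith)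
      rw [rectIntegral_gIntegrand θ α c hz 0 (by norm_num) (by norm_num) (by simpa using hr)
        (Or.inl rfl) hl hu, inv_mul_cancel_left₀ hpi] at h1
      rw [gInf, h1]
      simp
    | succ n ih =>
      have hn : (0 : ℝ) ≤ n := by positivity
      have hle : (1 / 2 - (n + 1 : ℕ) : ℝ) ≤ γ.right := by push_cast; linarith
      have hint' : (γ.withRight (1 / 2 - (n + 1 : ℕ))).Integrable (gIntegrand θ α c z) := by
        refine ⟨hint.1.mono_set (Iic_subset_Iic.2 hle), ?_,
          hint.2.2.mono_set (Iic_subset_Iic.2 hle)⟩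
        refine Continuous.intervalIntegrable ?_ _ _
        refine (continuousOn_gIntegrand θ α c hz).comp_continuous (by fun_prop) fun y m hm => ?_
        have h0 := (norm_inv_sin_le_of_re (n + 1) y).1
        simp only [LeftLoop.withRight] at hm
        rw [hm] at h0
        refine h0 ?_
        rw [mul_neg, Complex.sin_neg, mul_comm, Complex.sin_nat_mul_pi, neg_zero]
      have h1 := (γ.withRight (1 / 2 - (n + 1 : ℕ))).integral_sub_integral_withRight hint'
        (x := 1 / 2 - (n + 1 + 1 : ℕ)) (by
          simp only [LeftLoop.withRight]
          push_cast
          linarith)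
      have h2 := rectIntegral_gIntegrand θ α c hz (n + 1) (x₁ := 1 / 2 - (n + 1 + 1 : ℕ))
        (x₂ := 1 / 2 - (n + 1 : ℕ)) (y₁ := γ.lower) (y₂ := γ.upper) (by push_cast; linarith)
        (by push_cast; linarith) (by push_cast; linarith) (Or.inr (by push_cast; linarith)) hl hu
      simp only [LeftLoop.withRight] at h1 ih ⊢
      rw [h2, inv_mul_cancel_left₀ hpi] at h1
      rw [Finset.sum_range_succ, ih, ← h1]
      ring
  -- The integrand is `O(e^{Re u})` with one constant for all shifted loops, so the remainder decays
  -- like `e^{-n}`.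
  have hzero : Tendsto (fun n : ℕ =>
      (γ.withRight (1 / 2 - (n + 1 : ℕ))).integral (gIntegrand θ α c z)) atTop (𝓝 0) := by
    have hb : ∀ n : ℕ, ‖(γ.withRight (1 / 2 - (n + 1 : ℕ))).integral (gIntegrand θ α c z)‖ ≤
        ‖(2 * Real.pi * Complex.I : ℂ)⁻¹‖ *
          (C * (2 + (γ.upper - γ.lower)) * Real.exp (1 / 2 - (n + 1 : ℕ))) := by
      intro n
      have hn : (0 : ℝ) ≤ n := by positivity
      have hle : (1 / 2 - (n + 1 : ℕ) : ℝ) ≤ γ.right := by push_cast; linarith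
      exact (γ.withRight (1 / 2 - (n + 1 : ℕ))).norm_integral_le
        (fun x hx => hCl x (le_trans hx hle)) (fun x hx => hCu x (le_trans hx hle))
        (fun y hy => hCv (n + 1) hle y hy)
    refine squeeze_zero_norm hb ?_
    have he : Tendsto (fun n : ℕ => Real.exp (1 / 2 - (n + 1 : ℕ))) atTop (𝓝 0) := by
      refine Real.tendsto_exp_atBot.comp ?_
      refine tendsto_atBot_add_const_left _ (1 / 2 : ℝ) ?_
      exact tendsto_neg_atTop_atBot.comp
        (tendsto_natCast_atTop_atTop.comp (tendsto_add_atTop_nat 1))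
    simpa using (he.const_mul (C * (2 + (γ.upper - γ.lower)))).const_mul
      ‖(2 * Real.pi * Complex.I : ℂ)⁻¹‖
  rw [← tendsto_add_atTop_iff_nat 1]
  simp only [hstep]
  simpa using hzero.const_sub (gInf γ θ α c z)

lemma foxIntegrand_eq_gIntegrand (θ α c : ℝ) (z : ℂ) :
    foxIntegrand 1 0 ![] ![] ![0, -(α : ℂ), -(c : ℂ)] ![1, 1, θ] z = gIntegrand θ α c z := by
  funext u
  simp only [foxIntegrand, Finset.prod_filter, Fin.prod_univ_three, gIntegrand]
  simp
  rw [show (1 + α - u : ℂ) = α - u + 1 by ring, show (1 + c - θ * u : ℂ) = c - θ * u + 1 by ring]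
  ring

lemma foxSuitable_gIntegrand {θ : ℝ} (hθ : 0 < θ) (α c : ℝ) {z : ℂ} (hz : z ≠ 0)
    (hγ : ∀ x : ℝ, x ≤ 0 → γ.Encloses (x : ℂ))
    (hr : 0 < γ.right) (hl : γ.lower < 0) (hu : 0 < γ.upper) :
    FoxSuitable 1 0 ![] ![] ![0, -(α : ℂ), -(c : ℂ)] ![1, 1, θ] z γ := by
  refine ⟨fun j hj k => ?_, fun j => j.elim0, ?_⟩
  · obtain rfl : j = 0 := Fin.ext (by simpa using hj)
    have := hγ (-(k : ℝ)) (by simp)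
    simpa using this
  · rw [foxIntegrand_eq_gIntegrand]
    exact integrable_gIntegrand hθ α c hz hr hl hu

end Loop

/-! ### Asymptotics of the kernel and termwise integration -/

section Limit

/-- The normalisation `(s)_N / (N! N^{s-1})`, which tends to `1/Γ(s)`. -/
noncomputable def growthFactor (s : ℝ) (N : ℕ) : ℝ :=
  (∏ j ∈ Finset.range N, (s + j)) / N.factorial * N / (N : ℝ) ^ s

/-- Up to the factor `N/(N+s) → 1`, this is the reciprocal of Euler's sequence for `Γ(s)`. -/
lemma tendsto_growthFactor {s : ℝ} (hs : 0 < s) :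
    Tendsto (growthFactor s) atTop (𝓝 (Real.Gamma s)⁻¹) := by
  have h1 := (Real.GammaSeq_tendsto_Gamma s).inv₀ (Real.Gamma_pos_of_pos hs).ne'
  have h2 : Tendsto (fun N : ℕ => (N : ℝ) / (N + s)) atTop (𝓝 1) :=
    tendsto_natCast_div_add_atTop s
  have h3 := h1.mul h2
  rw [mul_one] at h3
  refine h3.congr' ?_
  filter_upwards [eventually_ge_atTop 1] with N hN
  have hN0 : (0 : ℝ) < N := by exact_mod_cast hN
  have hp := prod_range_add_ne_zero hs N
  have hNs : (N : ℝ) ^ s ≠ 0 := (Real.rpow_pos_of_pos hN0 s).ne'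
  rw [Real.GammaSeq, growthFactor, Finset.prod_range_succ]
  have : (N.factorial : ℝ) ≠ 0 := by positivity
  have : (s + N : ℝ) ≠ 0 := by positivity
  have : (N + s : ℝ) ≠ 0 := by positivity
  field_simp
  ring

/-- The correction `∏_{j<k} (1 - (j+1)/N)(1 + (s+j)/N)`. -/
noncomputable def correctionFactor (s : ℝ) (k N : ℕ) : ℝ :=
  ∏ j ∈ Finset.range k, (((N : ℝ) - (j + 1)) / N * ((s + N + j) / N))

lemma tendsto_correctionFactor (s : ℝ) (k : ℕ) :
    Tendsto (correctionFactor s k) atTop (𝓝 1) := by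
  have h1 : ∀ x : ℝ, Tendsto (fun N : ℕ => ((N : ℝ) + x) / N) atTop (𝓝 1) := by
    intro x
    have h2 : Tendsto (fun N : ℕ => 1 + x / (N : ℝ)) atTop (𝓝 (1 + 0)) :=
      (tendsto_const_div_atTop_nhds_zero_nat x).const_add 1
    rw [add_zero] at h2
    refine h2.congr' ?_
    filter_upwards [eventually_ge_atTop 1] with N hN
    have hN0 : (N : ℝ) ≠ 0 := by positivity
    field_simp
  have h3 : Tendsto (fun N : ℕ => ∏ j ∈ Finset.range k,
      (((N : ℝ) - (j + 1)) / N * ((s + N + j) / N))) atTop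
      (𝓝 (∏ j ∈ Finset.range k, (1 : ℝ))) := by
    refine tendsto_finsetProd _ fun j _ => ?_
    have := (h1 (-((j : ℝ) + 1))).mul (h1 (s + j))
    rw [mul_one] at this
    refine this.congr fun N => ?_
    congr 2
    ring
  rw [Finset.prod_const_one] at h3
  exact h3

/-- The factor `j = N - 1` vanishes. Hence the finite kernel sums can be written as series over all
indices. -/
lemma correctionFactor_eq_zero {s : ℝ} {k N : ℕ} (hN : 1 ≤ N) (hk : N ≤ k) :
    correctionFactor s k N = 0 := by
  refine Finset.prod_eq_zero (i := N - 1) (Finset.mem_range.2 (by omega)) ?_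
  rw [Nat.cast_sub hN]
  simp

/-- A bound uniform in `N`, for dominated convergence. For `k < N` the first factors lie in `[0,1]`,
and `(s+N+j)/N ≤ s+2` because `j < N` and `N ≥ 1`; otherwise the product is 0. -/
lemma abs_correctionFactor_le {s : ℝ} (hs : 0 < s) {k N : ℕ} (hN : 1 ≤ N) :
    |correctionFactor s k N| ≤ (s + 2) ^ k := by
  rcases le_or_gt N k with hk | hk
  · rw [correctionFactor_eq_zero hN hk, abs_zero]
    positivity
  have hN1 : (1 : ℝ) ≤ N := by exact_mod_cast hN
  have hN0 : (0 : ℝ) < N := by linarith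
  rw [correctionFactor, Finset.abs_prod, ← Finset.card_range k, ← Finset.prod_const,
    Finset.card_range]
  refine Finset.prod_le_prod (fun j _ => abs_nonneg _) fun j hj => ?_
  have hj' : (j : ℝ) + 1 ≤ N := by
    have := Finset.mem_range.1 hj
    exact_mod_cast (by omega : j + 1 ≤ N)
  have hj0 : (0 : ℝ) ≤ j := by positivity
  have e1 : 0 ≤ ((N : ℝ) - (j + 1)) / N := div_nonneg (by linarith) hN0.le
  have e2 : ((N : ℝ) - (j + 1)) / N ≤ 1 := by rw [div_le_one hN0]; linarith
  have e3 : 0 ≤ (s + N + j) / N := by positivity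
  have e4 : (s + N + j) / N ≤ s + 2 := by rw [div_le_iff₀ hN0]; nlinarith
  rw [abs_of_nonneg (mul_nonneg e1 e3)]
  calc _ ≤ 1 * (s + 2) := mul_le_mul e2 e4 e3 zero_le_one
    _ = _ := one_mul _

lemma Gamma_add_nat_real {s : ℝ} (hs : 0 < s) (k : ℕ) :
    Real.Gamma (s + k) = Real.Gamma s * ∏ j ∈ Finset.range k, (s + j) := by
  induction k with
  | zero => simp
  | succ k ih =>
    rw [Finset.prod_range_succ, ← mul_assoc, ← ih, Nat.cast_succ, ← add_assoc,
      Real.Gamma_add_one (by positivity), mul_comm]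

/-- The rescaled kernel coefficients. -/
noncomputable def scaledFactor (s : ℝ) (k N : ℕ) : ℝ :=
  (-1) ^ k / (k.factorial * Real.Gamma (s + k)) * Real.Gamma s *
    (growthFactor s N * correctionFactor s k N)

lemma kernelFactor_eq {s : ℝ} (hs : 0 < s) (k : ℕ) {N : ℕ} (hN : 1 ≤ N) :
    kernelFactor s k N = scaledFactor s k N * ((N : ℝ) ^ s * ((N : ℝ) ^ 2) ^ k) := by
  have hN0 : (0 : ℝ) < N := by exact_mod_cast hN
  have hNs : (N : ℝ) ^ s ≠ 0 := (Real.rpow_pos_of_pos hN0 s).ne'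
  have hG := (Real.Gamma_pos_of_pos hs).ne'
  have hp := prod_range_add_ne_zero hs k
  -- The extra factor `N - k` extends the falling factorial by one term; taking out its first term
  -- `N` explains the shift `j + 1` in `correctionFactor`.
  have h1 : ((N : ℝ) - k) * ∏ j ∈ Finset.range k, ((N : ℝ) - j) =
      N * ∏ j ∈ Finset.range k, ((N : ℝ) - (j + 1)) := by
    rw [mul_comm, ← Finset.prod_range_succ (fun j : ℕ => ((N : ℝ) - j)), Finset.prod_range_succ']
    push_cast
    rw [sub_zero, mul_comm]
  have h2 : correctionFactor s k N * ((N : ℝ) ^ 2) ^ k =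
      (∏ j ∈ Finset.range k, ((N : ℝ) - (j + 1))) * ∏ j ∈ Finset.range k, (s + N + j) := by
    rw [correctionFactor, ← Finset.prod_mul_distrib]
    conv_lhs =>
      rw [← Finset.card_range k, ← Finset.prod_const, Finset.card_range, ← Finset.prod_mul_distrib]
    refine Finset.prod_congr rfl fun j _ => ?_
    field_simp
  rw [kernelFactor, jacobiFactor, scaledFactor, growthFactor, Gamma_add_nat_real hs]
  generalize (∏ j ∈ Finset.range N, (s + (j : ℝ))) / N.factorial = W
  generalize (∏ j ∈ Finset.range k, (s + (j : ℝ))) = p at *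
  calc _ = (-1) ^ k / (k.factorial * p) * W * (((N : ℝ) - k) * ∏ j ∈ Finset.range k, ((N : ℝ) - j)) *
        ∏ j ∈ Finset.range k, (s + N + j) := by ring
    _ = (-1) ^ k / (k.factorial * p) * W * N * (correctionFactor s k N * ((N : ℝ) ^ 2) ^ k) := by
        rw [h1, h2]; ring
    _ = _ := by field_simp

lemma tendsto_scaledFactor {s : ℝ} (hs : 0 < s) (k : ℕ) :
    Tendsto (scaledFactor s k) atTop (𝓝 ((-1) ^ k / (k.factorial * Real.Gamma (s + k)))) := by
  have h1 := ((tendsto_growthFactor hs).mul (tendsto_correctionFactor s k)).const_mul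
    ((-1) ^ k / (k.factorial * Real.Gamma (s + k)) * Real.Gamma s)
  rw [mul_one, mul_inv_cancel_right₀ (Real.Gamma_pos_of_pos hs).ne'] at h1
  exact h1

lemma exists_inv_Gamma_le {x₀ : ℝ} (hx₀ : 0 < x₀) :
    ∃ M : ℝ, 0 ≤ M ∧ ∀ x, x₀ ≤ x → (Real.Gamma x)⁻¹ ≤ M := by
  obtain ⟨M, hM0, hM⟩ := exists_norm_inv_Gamma_le 0 x₀ 0
  refine ⟨M, hM0, fun x hx => ?_⟩
  have h1 := hM x (by simpa using hx) (by simp)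
  simp only [neg_zero, zero_mul, Real.exp_zero, mul_one, Complex.Gamma_ofReal, norm_inv,
    Complex.norm_real] at h1
  rwa [Real.norm_of_nonneg (Real.Gamma_pos_of_pos (by linarith)).le] at h1

/-- The convergent `growthFactor` is eventually below its limit plus 1, and `1/Γ(s+k)` is bounded in
`k`; the remaining `k!` makes the bound summable against powers. -/
lemma exists_abs_scaledFactor_le {s : ℝ} (hs : 0 < s) :
    ∃ C : ℝ, 0 ≤ C ∧ ∀ᶠ N : ℕ in atTop, ∀ k, |scaledFactor s k N| ≤ C * ((s + 2) ^ k / k.factorial) := by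
  obtain ⟨M, hM0, hM⟩ := exists_inv_Gamma_le hs
  have hG := Real.Gamma_pos_of_pos hs
  have hGi : 0 < (Real.Gamma s)⁻¹ := inv_pos.2 hG
  refine ⟨M * Real.Gamma s * ((Real.Gamma s)⁻¹ + 1), by positivity, ?_⟩
  have h1 := (tendsto_growthFactor hs).eventually_lt_const (lt_add_one _)
  filter_upwards [h1, eventually_ge_atTop 1] with N hN hN1 k
  have hg0 : 0 ≤ growthFactor s N := by
    unfold growthFactor
    have : 0 ≤ ∏ j ∈ Finset.range N, (s + (j : ℝ)) := Finset.prod_nonneg fun j _ => by positivity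
    positivity
  have hk := abs_correctionFactor_le hs hN1 (k := k)
  have hGk := Real.Gamma_pos_of_pos (by positivity : 0 < s + k)
  have hMk := hM (s + k) (by simp)
  rw [scaledFactor, div_eq_mul_inv, mul_inv]
  simp only [abs_mul, abs_pow, abs_neg, abs_one, one_pow, one_mul, abs_inv, Nat.abs_cast]
  rw [abs_of_pos hGk, abs_of_pos hG, abs_of_nonneg hg0]
  calc _ ≤ (k.factorial : ℝ)⁻¹ * M * Real.Gamma s * (((Real.Gamma s)⁻¹ + 1) * (s + 2) ^ k) := by
        gcongr
    _ = _ := by ring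

/-- The coefficients `(-1)^k x^k / (k! Γ(s+k) Γ(c+kθ+1))`. -/
noncomputable def realTerm (θ s c x : ℝ) (k : ℕ) : ℝ :=
  (-1) ^ k / (k.factorial * Real.Gamma (s + k)) * (x ^ k / Real.Gamma (c + k * θ + 1))

lemma ofReal_realTerm (θ α c x : ℝ) (k : ℕ) :
    (realTerm θ (α + 1) c x k : ℂ) = gTerm θ α c x k := by
  rw [realTerm, gTerm]
  push_cast [← Complex.Gamma_ofReal]
  rw [show (α + 1 + k : ℂ) = α + k + 1 by ring, show (c + k * θ + 1 : ℂ) = c + θ * k + 1 by ring]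
  simp only [div_eq_mul_inv, mul_inv]
  ring

lemma gTerm_mul (θ α c t x : ℝ) (k : ℕ) :
    gTerm θ α c ((t * x : ℝ) : ℂ) k = gTerm θ α c x k * (t : ℂ) ^ k := by
  rw [gTerm, gTerm]
  push_cast
  rw [mul_pow]
  ring

/-- The limit of the rescaled Christoffel–Darboux kernels as a double series. -/
lemma tendsto_scaled_cdKernel {a b θ : ℝ} (hθ : 0 < θ) (ha : -1 < a) (hb : -1 < b)
    (hab : 0 < a + b + 1) {P Q : ℕ → Polynomial ℝ} (hPQ : IsBiorthogonal a b θ P Q) {X Y : ℝ}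
    (hX : 0 < X) (hY : 0 < Y) :
    Tendsto (fun N : ℕ => (N : ℝ) ^ (-2 * (alpha a b θ + 1)) *
        cdKernel a b θ P Q N (X / (N : ℝ) ^ (2 / θ)) (Y / (N : ℝ) ^ (2 / θ))) atTop
      (𝓝 (θ * ∑' i : ℕ × ℕ, realTerm θ (alpha a b θ + 1) a (X ^ θ) i.1 *
        realTerm θ (alpha a b θ + 1) b (Y ^ θ) i.2 / (alpha a b θ + 1 + i.1 + i.2))) := by
  have hs := alpha_add_one_pos hθ hab
  set s := alpha a b θ + 1 with hsdef
  have hξ : 0 < X ^ θ := Real.rpow_pos_of_pos hX θ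
  have hη : 0 < Y ^ θ := Real.rpow_pos_of_pos hY θ
  set ξ := X ^ θ
  set η := Y ^ θ
  let T : (ℕ → ℝ) → (ℕ → ℝ) → ℕ × ℕ → ℝ := fun u v i =>
    (u i.1 * (ξ ^ i.1 / Real.Gamma (a + i.1 * θ + 1))) *
      (v i.2 * (η ^ i.2 / Real.Gamma (b + i.2 * θ + 1))) / (s + i.1 + i.2)
  have hker : ∀ᶠ N : ℕ in atTop, θ * ∑' i : ℕ × ℕ, T (scaledFactor s · N) (scaledFactor s · N) i =
      (N : ℝ) ^ (-2 * s) *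
        cdKernel a b θ P Q N (X / (N : ℝ) ^ (2 / θ)) (Y / (N : ℝ) ^ (2 / θ)) := by
    filter_upwards [eventually_ge_atTop 1] with N hN
    have hN0 : (0 : ℝ) < N := by exact_mod_cast hN
    -- The scale `N^{2/θ}` is chosen so that `x^θ` acquires `N^{-2}`, cancelling the growth
    -- `(N^2)^k` of the kernel coefficients.
    have hpow : ∀ Z : ℝ, 0 < Z → (Z / (N : ℝ) ^ (2 / θ)) ^ θ = Z ^ θ / (N : ℝ) ^ 2 := by
      intro Z hZ
      rw [Real.div_rpow hZ.le (Real.rpow_nonneg hN0.le _), ← Real.rpow_mul hN0.le,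
        div_mul_cancel₀ _ hθ.ne']
      norm_cast
    have hzero : ∀ i ∉ Finset.range N ×ˢ Finset.range N,
        T (scaledFactor s · N) (scaledFactor s · N) i = 0 := by
      intro i hi
      have : N ≤ i.1 ∨ N ≤ i.2 := by
        by_contra hcon
        push Not at hcon
        exact hi (Finset.mem_product.2 ⟨Finset.mem_range.2 hcon.1, Finset.mem_range.2 hcon.2⟩)
      rcases this with hk | hk
      · simp [T, scaledFactor, correctionFactor_eq_zero hN hk]
      · simp [T, scaledFactor, correctionFactor_eq_zero hN hk]
    rw [tsum_eq_sum hzero, Finset.sum_product, hPQ.cdKernel_eq hθ ha hb hab, hpow X hX, hpow Y hY,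
      ← hsdef, mul_left_comm]
    congr 1
    rw [Finset.mul_sum]
    refine Finset.sum_congr rfl fun k _ => ?_
    rw [Finset.mul_sum]
    refine Finset.sum_congr rfl fun l _ => ?_
    rw [kernelFactor_eq hs k hN, kernelFactor_eq hs l hN,
      show -2 * s = -(s + s) by ring, Real.rpow_neg hN0.le, Real.rpow_add hN0]
    have hNs : (N : ℝ) ^ s ≠ 0 := (Real.rpow_pos_of_pos hN0 s).ne'
    have h1 := (Gamma_shift_pos hθ ha k).ne'
    have h2 := (Gamma_shift_pos hθ hb l).ne'
    have h3 : s + k + l ≠ 0 := by positivity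
    simp only [T, div_pow, ξ, η]
    generalize Real.Gamma (a + k * θ + 1) = g1 at *
    generalize Real.Gamma (b + l * θ + 1) = g2 at *
    field_simp
  refine Tendsto.congr' hker (Tendsto.const_mul θ ?_)
  obtain ⟨C, hC0, hC⟩ := exists_abs_scaledFactor_le hs
  obtain ⟨Ma, hMa0, hMa⟩ := exists_inv_Gamma_le (show 0 < a + 1 by linarith)
  obtain ⟨Mb, hMb0, hMb⟩ := exists_inv_Gamma_le (show 0 < b + 1 by linarith)
  let G : ℝ → ℝ → ℕ → ℝ := fun M x k => C * M * (((s + 2) * x) ^ k / k.factorial)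
  have hGsum : ∀ M x, Summable (G M x) := fun M x =>
    (Real.summable_pow_div_factorial _).mul_left _
  have hfac : ∀ {c x M u : ℝ} {k : ℕ}, -1 < c → 0 < x → (∀ y, c + 1 ≤ y → (Real.Gamma y)⁻¹ ≤ M) →
      |u| ≤ C * ((s + 2) ^ k / k.factorial) →
      |u * (x ^ k / Real.Gamma (c + k * θ + 1))| ≤ G M x k := by
    intro c x M u k hc hx hM hu
    have hg := Gamma_shift_pos hθ hc k
    have hM' := hM (c + k * θ + 1) (by have : 0 ≤ (k : ℝ) * θ := by positivity
                                       linarith)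
    rw [abs_mul, abs_of_nonneg (by positivity : 0 ≤ x ^ k / Real.Gamma (c + k * θ + 1)),
      div_eq_mul_inv (x ^ k)]
    calc _ ≤ (C * ((s + 2) ^ k / k.factorial)) * (x ^ k * M) := by gcongr
      _ = _ := by simp only [G, mul_pow]; ring
  -- The dominating series is a product of two exponential series, with `1/(s+k+l) ≤ 1/s`.
  refine tendsto_tsum_of_dominated_convergence (bound := fun i : ℕ × ℕ =>
    (G Ma ξ i.1 * G Mb η i.2) * s⁻¹) ?_ ?_ ?_
  · refine Summable.mul_right _ ((hGsum Ma ξ).mul_of_nonneg (hGsum Mb η) ?_ ?_)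
    · intro k; simp only [G, Pi.zero_apply]; positivity
    · intro k; simp only [G, Pi.zero_apply]; positivity
  · intro i
    exact (((tendsto_scaledFactor hs i.1).mul_const _).mul
      ((tendsto_scaledFactor hs i.2).mul_const _)).div_const _
  · filter_upwards [hC] with N hN i
    have h1 := hfac ha hξ hMa (hN i.1)
    have h2 := hfac hb hη hMb (hN i.2)
    have h3 : 0 < s + i.1 + i.2 := by positivity
    have h4 : |s + i.1 + i.2|⁻¹ ≤ s⁻¹ := by
      rw [abs_of_pos h3]
      exact inv_anti₀ hs (by rw [add_assoc]; exact le_add_of_nonneg_right (by positivity))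
    rw [Real.norm_eq_abs, abs_div, abs_mul, div_eq_mul_inv]
    have h5 := (abs_nonneg _).trans h1
    have h6 := (abs_nonneg _).trans h2
    gcongr

variable {γ : LeftLoop}

/-- For `t > 0` the loop integral is a pointwise limit of polynomials in `t`, the partial sums of
its series. -/
lemma aestronglyMeasurable_gInf {θ : ℝ} (hθ : 0 < θ) (α c : ℝ) {x : ℝ} (hx : 0 < x)
    (hr : 0 < γ.right) (hl : γ.lower < 0) (hu : 0 < γ.upper) :
    AEStronglyMeasurable (fun t : ℝ => gInf γ θ α c ((t * x : ℝ) : ℂ))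
      (volume.restrict (Ioc 0 1)) := by
  refine aestronglyMeasurable_of_tendsto_ae atTop
    (f := fun (n : ℕ) (t : ℝ) => ∑ k ∈ Finset.range n, gTerm θ α c x k * (t : ℂ) ^ k)
    (fun n => ?_) ?_
  · exact Continuous.aestronglyMeasurable (by fun_prop)
  · filter_upwards [self_mem_ae_restrict measurableSet_Ioc] with t ht
    have hz : ((t * x : ℝ) : ℂ) ≠ 0 := by
      exact_mod_cast (mul_pos ht.1 hx).ne'
    have := (hasSum_gTerm (γ := γ) hθ α c hz hr hl hu).tendsto_sum_nat
    simpa only [gTerm_mul] using this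

lemma norm_gInf_le {θ : ℝ} (hθ : 0 < θ) (α c : ℝ) {t x : ℝ} (ht : t ∈ Ioc (0 : ℝ) 1) (hx : 0 < x)
    (hr : 0 < γ.right) (hl : γ.lower < 0) (hu : 0 < γ.upper) :
    ‖gInf γ θ α c ((t * x : ℝ) : ℂ)‖ ≤ ∑' k, ‖gTerm θ α c x k‖ := by
  have hz : ((t * x : ℝ) : ℂ) ≠ 0 := by
    exact_mod_cast (mul_pos ht.1 hx).ne'
  have hsum := hasSum_gTerm (γ := γ) hθ α c hz hr hl hu
  rw [← hsum.tsum_eq]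
  refine (norm_tsum_le_tsum_norm (summable_norm_gTerm hθ α c _)).trans ?_
  refine (summable_norm_gTerm hθ α c _).tsum_le_tsum (fun k => ?_) (summable_norm_gTerm hθ α c _)
  rw [gTerm_mul, norm_mul, norm_pow, Complex.norm_real, Real.norm_of_nonneg ht.1.le]
  exact mul_le_of_le_one_right (norm_nonneg _) (pow_le_one₀ ht.1.le ht.2)

/-- Both loop integrals are bounded on `(0,1]` by their absolute series at `t = 1`, and `t^α` is
integrable because `α > -1`. -/
lemma intervalIntegrable_gInf_mul_gInf {θ α : ℝ} (hθ : 0 < θ) (hα : 0 < α + 1) (a b : ℝ) {x y : ℝ}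
    (hx : 0 < x) (hy : 0 < y) (hr : 0 < γ.right) (hl : γ.lower < 0) (hu : 0 < γ.upper) :
    IntervalIntegrable (fun t : ℝ => ((t ^ α : ℝ) : ℂ) * gInf γ θ α a ((t * x : ℝ) : ℂ) *
      gInf γ θ α b ((t * y : ℝ) : ℂ)) volume 0 1 := by
  rw [intervalIntegrable_iff_integrableOn_Ioc_of_le zero_le_one]
  have h1 : IntegrableOn (fun t : ℝ => t ^ α) (Ioc 0 1) := by
    rw [← intervalIntegrable_iff_integrableOn_Ioc_of_le zero_le_one]
    exact intervalIntegral.intervalIntegrable_rpow' (by linarith)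
  have h2 := h1.mul_const ((∑' k, ‖gTerm θ α a x k‖) * ∑' k, ‖gTerm θ α b y k‖)
  refine Integrable.mono' h2 ?_ ?_
  · exact ((Complex.continuous_ofReal.comp_aestronglyMeasurable h1.1).mul
      (aestronglyMeasurable_gInf hθ α a hx hr hl hu)).mul
      (aestronglyMeasurable_gInf hθ α b hy hr hl hu)
  · filter_upwards [self_mem_ae_restrict measurableSet_Ioc] with t ht
    have hta : 0 ≤ t ^ α := Real.rpow_nonneg ht.1.le α
    rw [mul_assoc, norm_mul, norm_mul, Complex.norm_real, Real.norm_of_nonneg hta]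
    gcongr
    · exact norm_gInf_le hθ α a ht hx hr hl hu
    · exact norm_gInf_le hθ α b ht hy hr hl hu

/-- Termwise integration of the product of the two power series. -/
lemma integral_gInf_mul_gInf {θ α : ℝ} (hθ : 0 < θ) (hα : 0 < α + 1) (a b : ℝ) {x y : ℝ}
    (hx : 0 < x) (hy : 0 < y) (hr : 0 < γ.right) (hl : γ.lower < 0) (hu : 0 < γ.upper) :
    ∫ t in (0 : ℝ)..1, ((t ^ α : ℝ) : ℂ) * gInf γ θ α a ((t * x : ℝ) : ℂ) *
      gInf γ θ α b ((t * y : ℝ) : ℂ) =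
    ∑' i : ℕ × ℕ, gTerm θ α a x i.1 * gTerm θ α b y i.2 / (α + 1 + i.1 + i.2) := by
  let F : ℕ × ℕ → ℝ → ℂ := fun i t =>
    ((t ^ (α + i.1 + i.2) : ℝ) : ℂ) * (gTerm θ α a x i.1 * gTerm θ α b y i.2)
  have hexp : ∀ i : ℕ × ℕ, -1 < α + i.1 + i.2 := fun i => by
    have h1 : (0 : ℝ) ≤ i.1 := by positivity
    have h2 : (0 : ℝ) ≤ i.2 := by positivity
    linarith
  have hrint : ∀ i : ℕ × ℕ, IntegrableOn (fun t : ℝ => t ^ (α + i.1 + i.2)) (Ioc 0 1) := fun i => by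
    rw [← intervalIntegrable_iff_integrableOn_Ioc_of_le zero_le_one]
    exact intervalIntegral.intervalIntegrable_rpow' (hexp i)
  have hval : ∀ i : ℕ × ℕ, ∫ t in Ioc (0 : ℝ) 1, t ^ (α + i.1 + i.2) = 1 / (α + 1 + i.1 + i.2) := by
    intro i
    have hne : α + i.1 + i.2 + 1 ≠ 0 := by linarith [hexp i]
    rw [← intervalIntegral.integral_of_le zero_le_one, integral_rpow (Or.inl (hexp i)),
      Real.one_rpow, Real.zero_rpow hne, sub_zero]
    congr 1
    ring
  have hFint : ∀ i, Integrable (F i) (volume.restrict (Ioc 0 1)) := fun i =>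
    (hrint i).ofReal.mul_const _
  have hprod : Summable fun i : ℕ × ℕ => ‖gTerm θ α a x i.1‖ * ‖gTerm θ α b y i.2‖ :=
    (summable_norm_gTerm hθ α a x).mul_of_nonneg (summable_norm_gTerm hθ α b y)
      (fun _ => norm_nonneg _) (fun _ => norm_nonneg _)
  have hFnorm : ∀ i, ∫ t in Ioc (0 : ℝ) 1, ‖F i t‖ =
      1 / (α + 1 + i.1 + i.2) * (‖gTerm θ α a x i.1‖ * ‖gTerm θ α b y i.2‖) := by
    intro i
    rw [← hval, ← integral_mul_const]
    refine setIntegral_congr_fun measurableSet_Ioc fun t ht => ?_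
    simp only [F]
    rw [norm_mul, norm_mul, Complex.norm_real, Real.norm_of_nonneg (Real.rpow_nonneg ht.1.le _)]
  -- Justifies exchanging sum and integral: the `L¹` norms are at most `1/(α+1)` times a product of
  -- two absolutely convergent series.
  have hsum : Summable fun i => ∫ t in Ioc (0 : ℝ) 1, ‖F i t‖ := by
    refine Summable.of_nonneg_of_le (fun i => integral_nonneg fun t => norm_nonneg _) (fun i => ?_)
      (hprod.mul_left (1 / (α + 1)))
    rw [hFnorm]
    refine mul_le_mul_of_nonneg_right (one_div_le_one_div_of_le hα ?_) (by positivity)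
    rw [add_assoc (α + 1)]
    exact le_add_of_nonneg_right (by positivity)
  have hmain := (hasSum_integral_of_summable_integral_norm hFint hsum).tsum_eq
  rw [intervalIntegral.integral_of_le zero_le_one]
  calc _ = ∫ t in Ioc (0 : ℝ) 1, ∑' i, F i t := by
        refine setIntegral_congr_fun measurableSet_Ioc fun t ht => ?_
        have hx' : ((t * x : ℝ) : ℂ) ≠ 0 := by exact_mod_cast (mul_pos ht.1 hx).ne'
        have hy' : ((t * y : ℝ) : ℂ) ≠ 0 := by exact_mod_cast (mul_pos ht.1 hy).ne'
        rw [← (hasSum_gTerm (γ := γ) hθ α a hx' hr hl hu).tsum_eq,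
          ← (hasSum_gTerm (γ := γ) hθ α b hy' hr hl hu).tsum_eq, mul_assoc,
          tsum_mul_tsum_of_summable_norm (summable_norm_gTerm hθ α a _)
            (summable_norm_gTerm hθ α b _), ← tsum_mul_left]
        refine tsum_congr fun i => ?_
        simp only [F]
        rw [gTerm_mul, gTerm_mul, Real.rpow_add ht.1, Real.rpow_add ht.1, Real.rpow_natCast,
          Real.rpow_natCast]
        push_cast
        ring
    _ = _ := by
        rw [← hmain]
        refine tsum_congr fun i => ?_
        simp only [F]
        rw [integral_mul_const, integral_complex_ofReal, hval]
        push_cast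
        ring

end Limit

end CauchyLaguerre

/-! ### Assembly of the theorem -/

theorem mainTheorem4 (θ a b : ℝ) (hθ : 0 < θ) (ha : -1 < a) (hb : -1 < b)
    (hab : 0 < a + b + 1) :
    (∃ P Q : ℕ → Polynomial ℝ, CauchyLaguerre.IsBiorthogonal a b θ P Q) ∧
    ∀ γ : CauchyLaguerre.LeftLoop, (∀ x : ℝ, x ≤ 0 → γ.Encloses (x : ℂ)) →
      (∀ c : ℝ, -1 < c → ∀ z : ℂ, z ≠ 0 →
        γ.Integrable (CauchyLaguerre.gIntegrand θ (CauchyLaguerre.alpha a b θ) c z) ∧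
        HasSum (fun k : ℕ => (-1) ^ k * z ^ k /
            ((k.factorial : ℂ) *
              Complex.Gamma ((CauchyLaguerre.alpha a b θ : ℂ) + k + 1) *
              Complex.Gamma ((c : ℂ) + θ * k + 1)))
          (CauchyLaguerre.gInf γ θ (CauchyLaguerre.alpha a b θ) c z) ∧
        CauchyLaguerre.FoxSuitable 1 0 ![] ![]
          ![0, -(CauchyLaguerre.alpha a b θ : ℂ), -(c : ℂ)] ![1, 1, θ] z γ ∧
        CauchyLaguerre.gInf γ θ (CauchyLaguerre.alpha a b θ) c z =
          CauchyLaguerre.foxH 1 0 ![] ![]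
            ![0, -(CauchyLaguerre.alpha a b θ : ℂ), -(c : ℂ)] ![1, 1, θ] γ z) ∧
      ∀ X Y : ℝ, 0 < X → 0 < Y →
        IntervalIntegrable (fun t : ℝ =>
            ((t ^ CauchyLaguerre.alpha a b θ : ℝ) : ℂ) *
              CauchyLaguerre.gInf γ θ (CauchyLaguerre.alpha a b θ) a ((t * X ^ θ : ℝ) : ℂ) *
              CauchyLaguerre.gInf γ θ (CauchyLaguerre.alpha a b θ) b ((t * Y ^ θ : ℝ) : ℂ))
          volume 0 1 ∧
        ∀ P Q : ℕ → Polynomial ℝ, CauchyLaguerre.IsBiorthogonal a b θ P Q →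
          Tendsto (fun N : ℕ =>
              (((N : ℝ) ^ (-2 * (CauchyLaguerre.alpha a b θ + 1)) *
                CauchyLaguerre.cdKernel a b θ P Q N
                  (X / (N : ℝ) ^ (2 / θ)) (Y / (N : ℝ) ^ (2 / θ)) : ℝ) : ℂ))
            atTop
            (𝓝 ((θ : ℂ) * ∫ t in (0 : ℝ)..1,
              ((t ^ CauchyLaguerre.alpha a b θ : ℝ) : ℂ) *
                CauchyLaguerre.gInf γ θ (CauchyLaguerre.alpha a b θ) a ((t * X ^ θ : ℝ) : ℂ) *
                CauchyLaguerre.gInf γ θ (CauchyLaguerre.alpha a b θ) b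
                  ((t * Y ^ θ : ℝ) : ℂ))) := by
  have hs := CauchyLaguerre.alpha_add_one_pos (a := a) (b := b) hθ hab
  refine ⟨⟨_, _, CauchyLaguerre.isBiorthogonal_jacobiTransform hθ ha hb hab⟩, fun γ hγ => ?_⟩
  -- Enclosing the origin already fixes the signs of the three loop parameters.
  have h0 := hγ 0 le_rfl
  have hr : 0 < γ.right := by simpa using h0.1
  have hl : γ.lower < 0 := by simpa using h0.2.1
  have hu : 0 < γ.upper := by simpa using h0.2.2
  refine ⟨fun c _ z hz => ⟨CauchyLaguerre.integrable_gIntegrand hθ _ c hz hr hl hu,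
    CauchyLaguerre.hasSum_gTerm hθ _ c hz hr hl hu,
    CauchyLaguerre.foxSuitable_gIntegrand hθ _ c hz hγ hr hl hu, ?_⟩, fun X Y hX hY => ?_⟩
  · rw [CauchyLaguerre.foxH, CauchyLaguerre.foxIntegrand_eq_gIntegrand, CauchyLaguerre.gInf]
  have hξ : 0 < X ^ θ := Real.rpow_pos_of_pos hX θ
  have hη : 0 < Y ^ θ := Real.rpow_pos_of_pos hY θ
  refine ⟨CauchyLaguerre.intervalIntegrable_gInf_mul_gInf hθ hs a b hξ hη hr hl hu,
    fun P Q hPQ => ?_⟩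
  rw [CauchyLaguerre.integral_gInf_mul_gInf hθ hs a b hξ hη hr hl hu]
  have hlim := (Complex.continuous_ofReal.tendsto _).comp
    (CauchyLaguerre.tendsto_scaled_cdKernel hθ ha hb hab hPQ hX hY)
  convert! hlim using 2
  rw [Complex.ofReal_mul, Complex.ofReal_tsum]
  congr 1
  refine tsum_congr fun i => ?_
  push_cast [CauchyLaguerre.ofReal_realTerm]
  rfl
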